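/- All simplicial complexes are abstract simplicial complexes, identified with their geometric realizations. Write $v\sim w$ if $v\neq w$ span an edge. A complex is \emph{flag} if every nonempty finite set of pairwise adjacent vertices spans a simplex. The \emph{link} of a simplex $\sigma$ of $X$ is the subcomplex $X_\sigma=\{\tau\in X : \tau\cap\sigma=\emptyset,\ \tau\cup\sigma\in X\}$, and $B_1(v,X)$ denotes the full subcomplex of $X$ spanned by $v$ and all vertices adjacent to $v$. For $l\ge 4$, an \emph{$l$-wheel} $(v_0;v_1,\dots,v_l)$ in a flag complex $X$ consists of distinct vertices such that, for $1\le i,j\le l$, $v_i\sim v_j$ if and only if $i-j\equiv\pm1 \pmod l$, and $v_0\sim v_i$ for all $1\le i\le l$. An \emph{$l$-wheel with a pendant triangle} $(v_0;v_1,\dots,v_l;t)$ is the union of (the full subcomplex spanned by) an $l$-wheel and a triangle $\langle v_1,v_2,t\rangle$ of $X$ with $t\ne v_i$ for $i=0,\dots,l$; the union need not be a full subcomplex. For an integer $k\geq 5$, a flag complex $X$ satisfies $SD_2^{*}(k)$ if (a) $X$ contains no $4$-wheel, and (b) for every $5\le l<k$ and every $l$-wheel with a pendant triangle $\widehat W$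 in $X$ there is a vertex $v$ of $X$ with $\widehat W\subseteq B_1(v,X)$. A flag complex $X$ is a \emph{complex with $SD_2^{*}(k)$ links} if $X$ and the link of every simplex of $X$ satisfy $SD_2^{*}(k)$. \textbf{Theorem.} Let $k\geq 6$ and let $X$ be a compact (equivalently, finite) simplicial complex with $SD_2^{*}(k)$ links. Then for every base point $x\in X$ and every finitely presented subgroup $H\le\pi_1(X,x)$ there is a finite connected simplicial complex $Y$ with $SD_2^{*}(k)$ links such that $H\cong\pi_1(Y)$. -/

import Mathlib

/-! A simplicial complex is a `PreAbstractSimplicialComplex V`; its vertices are the `v : V` with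
`{v} ∈ X`. -/

namespace PreAbstractSimplicialComplex

variable {V : Type*}

/-- The geometric realization of a finite simplicial complex, as a subspace of `ℝ^V`: the union,
over all simplices `σ`, of the geometric simplex spanned by the basis vectors in `σ`. -/
def Realization [Fintype V] (X : PreAbstractSimplicialComplex V) : Set (V → ℝ) :=
  {f | f ∈ stdSimplex ℝ V ∧ ∃ σ ∈ X, ∀ v, f v ≠ 0 → v ∈ σ}

variable [DecidableEq V]

/-- Two distinct vertices are adjacent if they span an edge. -/
def Adj (X : PreAbstractSimplicialComplex V) (v w : V) : Prop :=
  v ≠ w ∧ {v, w} ∈ X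

/-- A complex is flag if every nonempty finite set of vertices which are pairwise joined by edges
spans a simplex (the case `v = w` says that the elements of `s` are vertices). -/
def IsFlag (X : PreAbstractSimplicialComplex V) : Prop :=
  ∀ s : Finset V, s.Nonempty → (∀ v ∈ s, ∀ w ∈ s, {v, w} ∈ X) → s ∈ X

/-- The link of `σ`: all simplices `τ` disjoint from `σ` such that `τ ∪ σ` spans a simplex. -/
def link (X : PreAbstractSimplicialComplex V) (σ : Finset V) : PreAbstractSimplicialComplex V where
  faces := {τ | τ ∈ X ∧ Disjoint τ σ ∧ τ ∪ σ ∈ X}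
  isRelLowerSet_faces := by
    rintro τ ⟨h1, h2, h3⟩
    refine ⟨(X.isRelLowerSet_faces h1).1, fun ρ hρ hne => ⟨?_, ?_, ?_⟩⟩
    · exact (X.isRelLowerSet_faces h1).2 hρ hne
    · exact Finset.disjoint_of_subset_left hρ h2
    · exact (X.isRelLowerSet_faces h3).2 (Finset.union_subset_union_left hρ)
        (hne.mono Finset.subset_union_left)

/-- `c` and the cyclically ordered vertices `v` form an `l`-wheel (`l ≥ 4`) of the flag complex
`X`: the `v i` are the vertices of a full `l`-cycle, and `c` is joined to each of them. In a flag
complex the span of these vertices is the cone over the cycle with apex `c`. -/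
structure IsWheel (X : PreAbstractSimplicialComplex V) (l : ℕ) (c : V) (v : ZMod l → V) :
    Prop where
  injective : Function.Injective v
  adj_iff : ∀ i j, X.Adj (v i) (v j) ↔ j = i + 1 ∨ i = j + 1
  adj_center : ∀ i, X.Adj c (v i)

/-- An `l`-wheel with a pendant triangle `⟨v 1, v 2, t⟩`. The union of the wheel and the triangle is
not required to be a full subcomplex. -/
structure IsWheelWithPendantTriangle (X : PreAbstractSimplicialComplex V) (l : ℕ) (c : V)
    (v : ZMod l → V) (t : V) : Prop where
  isWheel : X.IsWheel l c v
  triangle_mem : {v 1, v 2, t} ∈ X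
  ne_center : t ≠ c
  ne_cycle : ∀ i, t ≠ v i

/-- The vertex `u` lies in the combinatorial ball of radius `1` around the vertex `w`. As this ball
is a full subcomplex, it contains a subcomplex as soon as it contains its vertices. -/
def MemUnitBall (X : PreAbstractSimplicialComplex V) (w u : V) : Prop :=
  u = w ∨ X.Adj w u

/-- The property `SD₂*(k)`. -/
structure IsSD2Star (X : PreAbstractSimplicialComplex V) (k : ℕ) : Prop where
  isFlag : X.IsFlag
  no_four_wheel : ∀ c v, ¬ X.IsWheel 4 c v
  exists_ball : ∀ l : ℕ, 5 ≤ l → l < k → ∀ c v t, X.IsWheelWithPendantTriangle l c v t →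
    ∃ w, {w} ∈ X ∧ X.MemUnitBall w c ∧ (∀ i, X.MemUnitBall w (v i)) ∧ X.MemUnitBall w t

/-- A flag complex with `SD₂*(k)` links: the complex itself and the links of all its simplices have
the property `SD₂*(k)`. -/
structure HasSD2StarLinks (X : PreAbstractSimplicialComplex V) (k : ℕ) : Prop where
  isSD2Star : X.IsSD2Star k
  link_isSD2Star : ∀ σ ∈ X, (X.link σ).IsSD2Star k

end PreAbstractSimplicialComplex

/-! ### `SD₂*(k)` links as a condition local to the star of a vertex -/

namespace PreAbstractSimplicialComplex

variable {V W : Type*}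

/-! For a finite complex, having `SD₂*(k)` links is equivalent to a condition seen in unit balls:
there is no 4-wheel, and for `5 ≤ l < k` the tip of a pendant triangle is adjacent to the centre of
its wheel (`HasConedPendants`). This condition passes to every flag complex `Y` mapped to `X` so
that, along edge paths `a, b, d` of `Y`, the pair `a, d` spans a simplex as soon as its image does
(`of_local_pullback`).

Let `H` be given by finitely many generators and relators. Choose a vertex map `f` from `ℕ` onto the
vertices of `X` with infinite fibres. Drawing the generators as loops, and the null-homotopies in
`X` of the relators as triangles on fresh vertices, gives a finite connected complex `K` over `X`
and a surjection of the free group onto its edge path group which already kills the relations of `H`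
(`exists_diagram_of_presentation`).

The full preimage of `X` on the vertices of `K` contains `K` and has coned pendants. Among all such
complexes between `K` and this preimage take one, `Y`, with the fewest edges. The simplices of `Y`
whose edges are homotopic in `Y` to paths of `K` form a complex of the same kind, so by minimality
every edge of `Y` has this property, and the loops of `K` generate the edge path group of `Y`
(`IsDiagram.exists_hasConedPendants`). An element of that group which dies in `X` comes from a word
representing `1` in `H`, and this word is trivial already in `K`. Hence the edge path group of `Y`
injects into that of `X`, with image `H` (`HasConedPendants.exists_mulEquiv_edgeGroup`).

It remains to identify edge path groups with fundamental groups of realizations (`edgeGroupEquiv`).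
Surjectivity comes from subdividing a path along open stars; injectivity from the monodromy of a
covering built from the edge path group. -/

theorem mem_of_subset (X : PreAbstractSimplicialComplex V) {s t : Finset V} (hs : s ∈ X)
    (hts : t ⊆ s) (ht : t.Nonempty) : t ∈ X :=
  (X.isRelLowerSet_faces hs).2 hts ht

theorem nonempty_of_mem (X : PreAbstractSimplicialComplex V) {s : Finset V} (hs : s ∈ X) :
    s.Nonempty :=
  (X.isRelLowerSet_faces hs).1

variable [DecidableEq V] [DecidableEq W]

theorem pair_mem (X : PreAbstractSimplicialComplex V) {s : Finset V} (hs : s ∈ X) {a b : V}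
    (ha : a ∈ s) (hb : b ∈ s) : {a, b} ∈ X :=
  X.mem_of_subset hs (by grind) (by simp)

theorem singleton_mem (X : PreAbstractSimplicialComplex V) {s : Finset V} (hs : s ∈ X) {a : V}
    (ha : a ∈ s) : {a} ∈ X :=
  X.mem_of_subset hs (by simpa using ha) (by simp)

theorem pair_comm {X : PreAbstractSimplicialComplex V} {a b : V} (h : {a, b} ∈ X) :
    {b, a} ∈ X := by
  rwa [Finset.pair_comm]

theorem Adj.symm {X : PreAbstractSimplicialComplex V} {a b : V} (h : X.Adj a b) : X.Adj b a :=
  ⟨h.1.symm, pair_comm h.2⟩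

theorem IsFlag.triple_mem {X : PreAbstractSimplicialComplex V} (hX : X.IsFlag) {a b c : V}
    (hab : {a, b} ∈ X) (hbc : {b, c} ∈ X) (hac : {a, c} ∈ X) : {a, b, c} ∈ X := by
  refine hX _ (by simp) fun v hv w hw => ?_
  have ha : {a, a} ∈ X := X.pair_mem hab (by simp) (by simp)
  have hb : {b, b} ∈ X := X.pair_mem hab (by simp) (by simp)
  have hc : {c, c} ∈ X := X.pair_mem hbc (by simp) (by simp)
  simp only [Finset.mem_insert, Finset.mem_singleton] at hv hw
  rcases hv with rfl | rfl | rfl <;> rcases hw with rfl | rfl | rfl <;>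
    first | assumption | exact pair_comm ‹_›

theorem IsFlag.union_mem {X : PreAbstractSimplicialComplex V} (hX : X.IsFlag) {s t : Finset V}
    (hs : s ∈ X) (ht : t ∈ X) (h : ∀ a ∈ s, ∀ b ∈ t, {a, b} ∈ X) : s ∪ t ∈ X := by
  refine hX _ ((X.nonempty_of_mem hs).mono Finset.subset_union_left) fun v hv w hw => ?_
  rw [Finset.mem_union] at hv hw
  rcases hv with hv | hv <;> rcases hw with hw | hw
  · exact X.pair_mem hs hv hw
  · exact h v hv w hw
  · exact pair_comm (h w hw v hv)
  · exact X.pair_mem ht hv hw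

/-- A flag complex without `4`-wheels in which the apex of the pendant triangle of every `l`-wheel
with a pendant triangle, `5 ≤ l < k`, is adjacent to the center of the wheel. -/
structure HasConedPendants (X : PreAbstractSimplicialComplex V) (k : ℕ) : Prop where
  isFlag : X.IsFlag
  no_four_wheel : ∀ c v, ¬ X.IsWheel 4 c v
  adj_of_pendant : ∀ l : ℕ, 5 ≤ l → l < k → ∀ c v t, X.IsWheelWithPendantTriangle l c v t →
    X.Adj c t

theorem natCast_zmod_ne_zero {l n : ℕ} (h0 : 0 < n) (hn : n < l) : (n : ZMod l) ≠ 0 := by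
  rw [Ne, ZMod.natCast_eq_zero_iff]
  exact fun h => absurd (Nat.le_of_dvd h0 h) (by omega)

theorem zmod_small_ne_zero {l : ℕ} (hl : 4 ≤ l) :
    (1 : ZMod l) ≠ 0 ∧ (2 : ZMod l) ≠ 0 ∧ (3 : ZMod l) ≠ 0 := by
  refine ⟨?_, ?_, ?_⟩
  · simpa using natCast_zmod_ne_zero (l := l) (n := 1) (by omega) (by omega)
  · simpa using natCast_zmod_ne_zero (l := l) (n := 2) (by omega) (by omega)
  · simpa using natCast_zmod_ne_zero (l := l) (n := 3) (by omega) (by omega)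

theorem IsWheel.not_adj_add_two {X : PreAbstractSimplicialComplex V} {l : ℕ} {c : V}
    {v : ZMod l → V} (h : X.IsWheel l c v) (hl : 4 ≤ l) (i : ZMod l) :
    ¬ X.Adj (v i) (v (i + 2)) := by
  obtain ⟨h1, h2, h3⟩ := zmod_small_ne_zero hl
  rw [h.adj_iff]
  rintro (h | h)
  · exact h1 (by linear_combination h)
  · exact h3 (by linear_combination -h)

theorem IsWheel.ne_add_two {X : PreAbstractSimplicialComplex V} {l : ℕ} {c : V}
    {v : ZMod l → V} (h : X.IsWheel l c v) (hl : 4 ≤ l) (i : ZMod l) : v i ≠ v (i + 2) := by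
  intro e
  exact (zmod_small_ne_zero hl).2.1 (by linear_combination -(h.injective e))

/-- In the link of a simplex which is joined to all vertices of a wheel, this is a wheel too. -/
theorem IsWheel.link {X : PreAbstractSimplicialComplex V} (hX : X.IsFlag) {l : ℕ} {c : V}
    {v : ZMod l → V} (h : X.IsWheel l c v) {σ : Finset V} (hσ : σ ∈ X)
    (hc : ∀ s ∈ σ, X.Adj s c) (hv : ∀ s ∈ σ, ∀ i, X.Adj s (v i)) : (X.link σ).IsWheel l c v := by
  have key : ∀ a b, X.Adj a b → (∀ s ∈ σ, X.Adj s a) → (∀ s ∈ σ, X.Adj s b) →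
      (X.link σ).Adj a b := by
    intro a b hab ha hb
    refine ⟨hab.1, hab.2, ?_, hX.union_mem hab.2 hσ ?_⟩
    · rw [Finset.disjoint_right]
      intro s hs h'
      simp only [Finset.mem_insert, Finset.mem_singleton] at h'
      rcases h' with rfl | rfl
      · exact (ha _ hs).1 rfl
      · exact (hb _ hs).1 rfl
    · intro u hu s hs
      simp only [Finset.mem_insert, Finset.mem_singleton] at hu
      rcases hu with rfl | rfl
      · exact pair_comm (ha _ hs).2
      · exact pair_comm (hb _ hs).2
  refine ⟨h.injective, fun i j => ⟨fun h' => (h.adj_iff i j).1 ⟨h'.1, h'.2.1⟩, fun h' => ?_⟩,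
    fun i => key _ _ (h.adj_center i) hc fun s hs => hv s hs i⟩
  exact key _ _ ((h.adj_iff i j).2 h') (fun s hs => hv s hs i) fun s hs => hv s hs j

/-- The vertex `w` given by the ball condition may differ from the centre `c`. If it also differs
from `t`, it is joined to the whole configuration, which therefore lies in the link of `w`, and the
condition applies again there. The vertices found in this way span growing simplices `σ`, so by
finiteness the process stops, and it can stop only at `w = c` or `w = t`. -/
theorem HasSD2StarLinks.adj_of_pendant [Fintype V] {X : PreAbstractSimplicialComplex V} {k : ℕ}
    (hX : X.HasSD2StarLinks k) {l : ℕ} (hl : 5 ≤ l) (hlk : l < k) {c : V} {v : ZMod l → V} {t : V}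
    (h : X.IsWheelWithPendantTriangle l c v t) (n : ℕ) : ∀ σ : Finset V,
    Fintype.card V - σ.card = n → (σ = ∅ ∨ σ ∈ X) →
    (∀ s ∈ σ, X.Adj s c ∧ X.Adj s t ∧ ∀ i, X.Adj s (v i)) → X.Adj c t := by
  induction n using Nat.strong_induction_on with
  | _ n ih =>
  intro σ hn hσ hadj
  have hflag := hX.isSD2Star.isFlag
  -- The empty set is not a simplex, so the start of the induction uses `X` itself in place of a
  -- link.
  have : ∃ w, w ∉ σ ∧ insert w σ ∈ X ∧ X.MemUnitBall w c ∧ (∀ i, X.MemUnitBall w (v i)) ∧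
      X.MemUnitBall w t := by
    rcases hσ with rfl | hσ
    · obtain ⟨w, h0, h1, h2, h3⟩ := hX.isSD2Star.exists_ball l hl hlk c v t h
      exact ⟨w, by simp, by simpa using h0, h1, h2, h3⟩
    · have hw : (X.link σ).IsWheelWithPendantTriangle l c v t := by
        refine ⟨h.isWheel.link hflag hσ (fun s hs => (hadj s hs).1) fun s hs => (hadj s hs).2.2,
          ⟨h.triangle_mem, ?_, hflag.union_mem h.triangle_mem hσ ?_⟩, h.ne_center, h.ne_cycle⟩
        · rw [Finset.disjoint_right]
          intro s hs h'
          simp only [Finset.mem_insert, Finset.mem_singleton] at h'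
          rcases h' with rfl | rfl | rfl
          · exact ((hadj _ hs).2.2 1).1 rfl
          · exact ((hadj _ hs).2.2 2).1 rfl
          · exact (hadj _ hs).2.1.1 rfl
        · intro u hu s hs
          simp only [Finset.mem_insert, Finset.mem_singleton] at hu
          rcases hu with rfl | rfl | rfl
          · exact pair_comm ((hadj _ hs).2.2 1).2
          · exact pair_comm ((hadj _ hs).2.2 2).2
          · exact pair_comm (hadj _ hs).2.1.2
      obtain ⟨w, h0, h1, h2, h3⟩ := (hX.link_isSD2Star σ hσ).exists_ball l hl hlk c v t hw
      have hle : ∀ u, (X.link σ).MemUnitBall w u → X.MemUnitBall w u :=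
        fun u hu => hu.imp id fun h => ⟨h.1, h.2.1⟩
      refine ⟨w, ?_, h0.2.2, hle _ h1, fun i => hle _ (h2 i), hle _ h3⟩
      simpa using h0.2.1
  obtain ⟨w, hw, hins, h1, h2, h3⟩ := this
  by_cases hwc : w = c
  · subst hwc
    exact h3.resolve_left h.ne_center
  by_cases hwt : w = t
  · subst hwt
    exact (h1.resolve_left (Ne.symm hwc)).symm
  -- A cycle vertex cannot be `w`: its ball misses the vertex two steps further along the full
  -- cycle.
  by_cases hwv : ∃ i, w = v i
  · obtain ⟨i, rfl⟩ := hwv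
    rcases h2 (i + 2) with h' | h'
    · exact absurd h'.symm (h.isWheel.ne_add_two (by omega) i)
    · exact absurd h' (h.isWheel.not_adj_add_two (by omega) i)
  push Not at hwv
  have hcard : (insert w σ).card = σ.card + 1 := Finset.card_insert_of_notMem hw
  have hle : (insert w σ).card ≤ Fintype.card V := Finset.card_le_univ _
  refine ih (Fintype.card V - (insert w σ).card) (by omega) (insert w σ) rfl (Or.inr hins) ?_
  intro s hs
  rcases Finset.mem_insert.1 hs with rfl | hs
  · exact ⟨h1.resolve_left (Ne.symm hwc), h3.resolve_left (Ne.symm hwt),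
      fun i => (h2 i).resolve_left (Ne.symm (hwv i))⟩
  · exact hadj s hs

theorem HasSD2StarLinks.hasConedPendants [Fintype V] {X : PreAbstractSimplicialComplex V} {k : ℕ}
    (hX : X.HasSD2StarLinks k) : X.HasConedPendants k :=
  ⟨hX.isSD2Star.isFlag, hX.isSD2Star.no_four_wheel, fun _ hl hlk _ _ _ h =>
    hX.adj_of_pendant hl hlk h _ ∅ rfl (Or.inl rfl) (by simp)⟩

theorem HasConedPendants.isSD2Star {X : PreAbstractSimplicialComplex V} {k : ℕ}
    (hX : X.HasConedPendants k) : X.IsSD2Star k :=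
  ⟨hX.isFlag, hX.no_four_wheel, fun l hl hlk c v t h =>
    ⟨c, X.singleton_mem (h.isWheel.adj_center 0).2 (by simp), Or.inl rfl,
      fun i => Or.inr (h.isWheel.adj_center i), Or.inr (hX.adj_of_pendant l hl hlk c v t h)⟩⟩

/-- If the vertex map `g` from a flag complex `Y` to `X` maps edges to simplices and the balls of
radius one are pulled back from `X`, then `Y` inherits the condition on pendant triangles. -/
theorem HasConedPendants.of_local_pullback {X : PreAbstractSimplicialComplex V} {k : ℕ}
    (hX : X.HasConedPendants k) {Y : PreAbstractSimplicialComplex W} (hY : Y.IsFlag) (g : W → V)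
    (hg : ∀ a b, {a, b} ∈ Y → {g a, g b} ∈ X)
    (hloc : ∀ a b d, {a, b} ∈ Y → {b, d} ∈ Y → {g a, g d} ∈ X → {a, d} ∈ Y) :
    Y.HasConedPendants k := by
  -- Wheels map to wheels: any two rim vertices have the common neighbour `c`, so a collision or a
  -- chord in the image would pull back to a chord of the rim.
  have wheel : ∀ l : ℕ, 4 ≤ l → ∀ c v, Y.IsWheel l c v → X.IsWheel l (g c) (g ∘ v) := by
    intro l hl c v h
    obtain ⟨n1, n2, n3⟩ := zmod_small_ne_zero hl
    have pull : ∀ i j, {g (v i), g (v j)} ∈ X → {v i, v j} ∈ Y := fun i j =>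
      hloc _ _ _ (h.adj_center i).symm.2 (h.adj_center j).2
    have pullne : ∀ i, {g (v i), g (v (i + 2))} ∉ X := fun i hi =>
      h.not_adj_add_two hl i ⟨h.ne_add_two hl i, pull _ _ hi⟩
    have edge : ∀ i, {g (v i), g (v (i + 1))} ∈ X := fun i =>
      hg _ _ ((h.adj_iff i (i + 1)).2 (Or.inl rfl)).2
    have succ_ne : ∀ i, g (v i) ≠ g (v (i + 1)) := by
      intro i e
      have := edge (i + 1)
      rw [← e, add_assoc, one_add_one_eq_two] at this
      exact pullne i this
    have inj : Function.Injective (g ∘ v) := by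
      intro i j e
      by_contra hij
      have hi : {g (v i)} ∈ X := X.singleton_mem (edge i) (by simp)
      have : {g (v i), g (v j)} ∈ X := by
        rw [show g (v j) = g (v i) from e.symm]
        simpa using hi
      rcases (h.adj_iff i j).1 ⟨fun h' => hij (h.injective h'), pull _ _ this⟩ with rfl | rfl
      · exact succ_ne _ e
      · exact succ_ne _ e.symm
    refine ⟨inj, fun i j => ⟨fun h' => ?_, fun h' => ?_⟩, fun i => ⟨fun e => ?_, ?_⟩⟩
    · exact (h.adj_iff i j).1 ⟨fun e => h'.1 (by simp [e]), pull _ _ h'.2⟩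
    · have hadj := (h.adj_iff i j).2 h'
      exact ⟨fun e => hadj.1 (by rw [inj e]), hg _ _ hadj.2⟩
    · have := hg _ _ (h.adj_center (i + 2)).2
      rw [e] at this
      exact pullne i this
    · exact hg _ _ (h.adj_center i).2
  refine ⟨hY, fun c v h => hX.no_four_wheel _ _ (wheel 4 le_rfl c v h), ?_⟩
  intro l hl hlk c v t h
  obtain ⟨n1, n2, n3⟩ := zmod_small_ne_zero (show 4 ≤ l by omega)
  have n4 : (4 : ZMod l) ≠ 0 := by
    simpa using natCast_zmod_ne_zero (l := l) (n := 4) (by omega) (by omega)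
  have hw := wheel l (by omega) c v h.isWheel
  have h1t : {v 1, t} ∈ Y := Y.pair_mem h.triangle_mem (by simp) (by simp)
  have h2t : {v 2, t} ∈ Y := Y.pair_mem h.triangle_mem (by simp) (by simp)
  have h12 : {v 1, v 2} ∈ Y := Y.pair_mem h.triangle_mem (by simp) (by simp)
  refine ⟨h.ne_center.symm, hloc c (v 1) t (h.isWheel.adj_center 1).2 h1t ?_⟩
  have hXc : {g c} ∈ X := X.singleton_mem (hw.adj_center 0).2 (by simp)
  -- The image of `t` may fall onto the image of the wheel, but then `g c` and `g t` span a simplex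
  -- anyway.
  by_cases hc : g t = g c
  · rw [hc]
    simpa using hXc
  by_cases hv : ∃ i, g t = g (v i)
  · obtain ⟨i, hi⟩ := hv
    rw [hi]
    exact (hw.adj_center i).2
  push Not at hv
  refine (hX.adj_of_pendant l hl hlk (g c) (g ∘ v) (g t) ⟨hw, ?_, hc, hv⟩).2
  exact hX.isFlag.triple_mem (hg _ _ h12) (hg _ _ h2t) (hg _ _ h1t)

theorem isFlag_link {X : PreAbstractSimplicialComplex V} (hX : X.IsFlag) {σ : Finset V}
    (hσ : σ ∈ X) : (X.link σ).IsFlag := by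
  intro s hs h
  have hsX : s ∈ X := hX s hs fun a ha b hb => (h a ha b hb).1
  refine ⟨hsX, ?_, hX.union_mem hsX hσ fun a ha b hb => ?_⟩
  · rw [Finset.disjoint_left]
    intro a ha
    exact Finset.disjoint_left.1 (h a ha a ha).2.1 (by simp)
  · exact X.pair_mem (h a ha a ha).2.2 (by simp) (by simp [hb])

/-- Disjointness from `σ` and being joined to `σ` are conditions on single vertices, so by flagness
the link is a full subcomplex and the local pullback criterion applies to the identity. -/
theorem HasConedPendants.link {X : PreAbstractSimplicialComplex V} {k : ℕ}
    (hX : X.HasConedPendants k) {σ : Finset V} (hσ : σ ∈ X) : (X.link σ).HasConedPendants k := by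
  refine hX.of_local_pullback (isFlag_link hX.isFlag hσ) id (fun a b h => h.1) ?_
  intro a b d hab hbd had
  have ha : ({a} : Finset V) ∈ X.link σ := (X.link σ).singleton_mem hab (by simp)
  have hd : ({d} : Finset V) ∈ X.link σ := (X.link σ).singleton_mem hbd (by simp)
  refine ⟨had, ?_, hX.isFlag.union_mem had hσ ?_⟩
  · have h1 := ha.2.1
    have h2 := hd.2.1
    simp only [Finset.disjoint_singleton_left] at h1 h2
    simp [h1, h2]
  · intro u hu s hs
    simp only [Finset.mem_insert, Finset.mem_singleton] at hu
    rcases hu with rfl | rfl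
    · exact X.pair_mem ha.2.2 (by simp) (by simp [hs])
    · exact X.pair_mem hd.2.2 (by simp) (by simp [hs])

theorem HasConedPendants.hasSD2StarLinks {X : PreAbstractSimplicialComplex V} {k : ℕ}
    (hX : X.HasConedPendants k) : X.HasSD2StarLinks k :=
  ⟨hX.isSD2Star, fun _ hσ => (hX.link hσ).isSD2Star⟩

end PreAbstractSimplicialComplex

/-! ### Edge paths, their homotopies and the edge path group -/

namespace PreAbstractSimplicialComplex

variable {V W : Type*} [DecidableEq V] [DecidableEq W]

/-- `X.IsPath a l b`: the vertex `a`, followed by the vertices in the list `l`, is an edge path of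
`X` which ends in `b`. Consecutive vertices may agree. -/
def IsPath (X : PreAbstractSimplicialComplex V) : V → List V → V → Prop
  | a, [], b => a = b
  | a, c :: l, b => {a, c} ∈ X ∧ IsPath X c l b

/-- Elementary homotopies of edge paths starting at a given vertex. -/
inductive Step (X : PreAbstractSimplicialComplex V) : V → List V → List V → Prop
  | stay {a : V} {l : List V} : {a} ∈ X → Step X a (a :: l) l
  | tri {a b c : V} {l : List V} : {a, b, c} ∈ X → Step X a (b :: c :: l) (c :: l)
  | cons {a b : V} {l l' : List V} : Step X b l l' → Step X a (b :: l) (b :: l')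

/-- Homotopy of edge paths starting at a given vertex. -/
def Htpy (X : PreAbstractSimplicialComplex V) (a : V) : List V → List V → Prop :=
  Relation.EqvGen (X.Step a)

section

variable {X Y : PreAbstractSimplicialComplex V} {a b c : V} {l l' m m' : List V}

theorem Htpy.refl : X.Htpy a l l := Relation.EqvGen.refl _

theorem Htpy.symm (h : X.Htpy a l l') : X.Htpy a l' l := Relation.EqvGen.symm _ _ h

theorem Htpy.trans (h : X.Htpy a l l') (h' : X.Htpy a l' m) : X.Htpy a l m :=
  Relation.EqvGen.trans _ _ _ h h'

theorem Step.htpy (h : X.Step a l l') : X.Htpy a l l' := Relation.EqvGen.rel _ _ h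

theorem Htpy.stay (h : {a} ∈ X) : X.Htpy a (a :: l) l := (Step.stay h).htpy

theorem Htpy.tri (h : {a, b, c} ∈ X) : X.Htpy a (b :: c :: l) (c :: l) := (Step.tri h).htpy

theorem Htpy.cons (h : X.Htpy b l l') : X.Htpy a (b :: l) (b :: l') := by
  induction h with
  | rel _ _ h => exact (Step.cons h).htpy
  | refl _ => exact .refl
  | symm _ _ _ ih => exact ih.symm
  | trans _ _ _ _ _ ih ih' => exact ih.trans ih'

theorem Step.append_right (h : X.Step a l l') (m : List V) : X.Step a (l ++ m) (l' ++ m) := by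
  induction h with
  | stay h => exact .stay h
  | tri h => exact .tri h
  | cons _ ih => exact .cons ih

theorem Htpy.append_right (h : X.Htpy a l l') (m : List V) :
    X.Htpy a (l ++ m) (l' ++ m) := by
  induction h with
  | rel _ _ h => exact (h.append_right m).htpy
  | refl _ => exact .refl
  | symm _ _ _ ih => exact ih.symm
  | trans _ _ _ _ _ ih ih' => exact ih.trans ih'

theorem Htpy.append_left (hl : X.IsPath a l b) (h : X.Htpy b m m') :
    X.Htpy a (l ++ m) (l ++ m') := by
  induction l generalizing a with
  | nil => obtain rfl : a = b := hl; exact h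
  | cons c l ih => exact (ih hl.2).cons

theorem Htpy.append (hl : X.IsPath a l b) (h : X.Htpy a l l') (h' : X.Htpy b m m') :
    X.Htpy a (l ++ m) (l' ++ m') :=
  (h'.append_left hl).trans (h.append_right m')

theorem IsPath.append (hl : X.IsPath a l b) (hm : X.IsPath b m c) : X.IsPath a (l ++ m) c := by
  induction l generalizing a with
  | nil => obtain rfl : a = b := hl; exact hm
  | cons d l ih => exact ⟨hl.1, ih hl.2⟩

theorem IsPath.end_mem (hl : X.IsPath a l b) (ha : {a} ∈ X) : {b} ∈ X := by
  induction l generalizing a with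
  | nil => obtain rfl : a = b := hl; exact ha
  | cons d l ih => exact ih hl.2 (X.singleton_mem hl.1 (by simp))

theorem IsPath.end_unique {b' : V} (hl : X.IsPath a l b) (hl' : X.IsPath a l b') : b = b' := by
  induction l generalizing a with
  | nil => exact (hl : a = b).symm.trans hl'
  | cons d l ih => exact ih hl.2 hl'.2

theorem Step.isPath_iff (h : X.Step a l l') : X.IsPath a l b ↔ X.IsPath a l' b := by
  induction h with
  | stay h => exact ⟨fun h' => h'.2, fun h' => ⟨by simpa using h, h'⟩⟩
  | tri h =>
    exact ⟨fun h' => ⟨X.pair_mem h (by simp) (by simp), h'.2.2⟩,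
      fun h' => ⟨X.pair_mem h (by simp) (by simp), X.pair_mem h (by simp) (by simp), h'.2⟩⟩
  | cons _ ih => exact and_congr Iff.rfl ih

theorem Htpy.isPath_iff (h : X.Htpy a l l') : X.IsPath a l b ↔ X.IsPath a l' b := by
  induction h with
  | rel _ _ h => exact h.isPath_iff
  | refl _ => exact Iff.rfl
  | symm _ _ _ ih => exact ih.symm
  | trans _ _ _ _ _ ih ih' => exact ih.trans ih'

theorem Htpy.back_forth (h : {a, b} ∈ X) : X.Htpy a (b :: a :: l) l := by
  have h' : ({a, b, a} : Finset V) ∈ X := by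
    rwa [show ({a, b, a} : Finset V) = {a, b} by ext; simp; tauto]
  exact (Htpy.tri h').trans (.stay (X.singleton_mem h (by simp)))

theorem IsPath.exists_inv (hl : X.IsPath a l b) :
    ∃ l', X.IsPath b l' a ∧ X.Htpy a (l ++ l') [] ∧ X.Htpy b (l' ++ l) [] := by
  induction l generalizing a with
  | nil => obtain rfl : a = b := hl; exact ⟨[], rfl, .refl, .refl⟩
  | cons c l ih =>
    obtain ⟨m, h1, h2, h3⟩ := ih hl.2
    refine ⟨m ++ [a], h1.append ⟨pair_comm hl.1, rfl⟩, ?_, ?_⟩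
    · have : X.Htpy a (c :: ((l ++ m) ++ [a])) (c :: ([] ++ [a])) := (h2.append_right [a]).cons
      simpa using this.trans (.back_forth hl.1)
    · have : X.Htpy b (m ++ (a :: c :: l)) (m ++ l) :=
        Htpy.append_left h1 (.back_forth (pair_comm hl.1))
      simpa using this.trans h3

theorem IsPath.mono (h : X.IsPath a l b) (hXY : X ≤ Y) : Y.IsPath a l b := by
  induction l generalizing a with
  | nil => exact h
  | cons d l ih => exact ⟨hXY h.1, ih h.2⟩

theorem Step.mono (h : X.Step a l l') (hXY : X ≤ Y) : Y.Step a l l' := by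
  induction h with
  | stay h => exact .stay (hXY h)
  | tri h => exact .tri (hXY h)
  | cons _ ih => exact .cons ih

theorem Htpy.mono (h : X.Htpy a l l') (hXY : X ≤ Y) : Y.Htpy a l l' := by
  induction h with
  | rel _ _ h => exact (h.mono hXY).htpy
  | refl _ => exact .refl
  | symm _ _ _ ih => exact ih.symm
  | trans _ _ _ _ _ ih ih' => exact ih.trans ih'

/-- The vertex map `f` is a simplicial map. -/
def IsSimplicial (f : W → V) (Z : PreAbstractSimplicialComplex W)
    (X : PreAbstractSimplicialComplex V) : Prop :=
  ∀ s ∈ Z, s.image f ∈ X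

theorem IsSimplicial.pair {f : W → V} {Z : PreAbstractSimplicialComplex W}
    (hf : IsSimplicial f Z X) {a b : W} (h : {a, b} ∈ Z) : {f a, f b} ∈ X := by
  simpa [Finset.image_insert] using hf _ h

theorem IsSimplicial.singleton {f : W → V} {Z : PreAbstractSimplicialComplex W}
    (hf : IsSimplicial f Z X) {a : W} (h : {a} ∈ Z) : {f a} ∈ X := by
  simpa using hf _ h

theorem IsPath.map {f : W → V} {Z : PreAbstractSimplicialComplex W} (hf : IsSimplicial f Z X)
    {a b : W} {l : List W} (h : Z.IsPath a l b) : X.IsPath (f a) (l.map f) (f b) := by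
  induction l generalizing a with
  | nil => exact congrArg f h
  | cons d l ih => exact ⟨hf.pair h.1, ih h.2⟩

theorem Step.map {f : W → V} {Z : PreAbstractSimplicialComplex W} (hf : IsSimplicial f Z X)
    {a : W} {l l' : List W} (h : Z.Step a l l') : X.Step (f a) (l.map f) (l'.map f) := by
  induction h with
  | stay h => exact .stay (hf.singleton h)
  | tri h => exact .tri (by simpa [Finset.image_insert] using hf _ h)
  | cons _ ih => exact .cons ih

theorem Htpy.map {f : W → V} {Z : PreAbstractSimplicialComplex W} (hf : IsSimplicial f Z X)
    {a : W} {l l' : List W} (h : Z.Htpy a l l') : X.Htpy (f a) (l.map f) (l'.map f) := by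
  induction h with
  | rel _ _ h => exact (h.map hf).htpy
  | refl _ => exact .refl
  | symm _ _ _ ih => exact ih.symm
  | trans _ _ _ _ _ ih ih' => exact ih.trans ih'

end

/-- Edge loops at a vertex up to homotopy. -/
instance loopSetoid (X : PreAbstractSimplicialComplex V) (v : V) :
    Setoid {l : List V // X.IsPath v l v} where
  r l l' := X.Htpy v l l'
  iseqv := ⟨fun _ => .refl, fun h => h.symm, fun h h' => h.trans h'⟩

/-- The edge path group of a simplicial complex. In a product, the right factor is traversed first,
as in Mathlib's `FundamentalGroup`. -/
def EdgeGroup (X : PreAbstractSimplicialComplex V) (v : V) : Type _ :=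
  Quotient (X.loopSetoid v)

namespace EdgeGroup

variable {X Y Z : PreAbstractSimplicialComplex V} {v : V}

/-- The class of an edge loop. -/
def mk (l : List V) (hl : X.IsPath v l v) : X.EdgeGroup v := Quotient.mk _ ⟨l, hl⟩

theorem mk_eq_mk {l l' : List V} {hl : X.IsPath v l v} {hl' : X.IsPath v l' v} :
    mk l hl = mk l' hl' ↔ X.Htpy v l l' := Quotient.eq

theorem exists_mk (g : X.EdgeGroup v) : ∃ l hl, mk l hl = g := by
  obtain ⟨⟨l, hl⟩, rfl⟩ := Quotient.exists_rep g
  exact ⟨l, hl, rfl⟩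

instance : Monoid (X.EdgeGroup v) where
  mul := Quotient.map₂ (fun l m => ⟨m.1 ++ l.1, m.2.append l.2⟩)
    fun _ _ h m _ h' => Htpy.append m.2 h' h
  one := mk [] rfl
  mul_assoc := by
    rintro ⟨l⟩ ⟨m⟩ ⟨n⟩
    exact mk_eq_mk.2 (by rw [List.append_assoc]; exact .refl)
  one_mul := by
    rintro ⟨l⟩
    exact mk_eq_mk.2 (by rw [List.append_nil]; exact .refl)
  mul_one := by
    rintro ⟨l⟩
    exact mk_eq_mk.2 .refl

theorem mk_mul_mk {l m : List V} (hl : X.IsPath v l v) (hm : X.IsPath v m v) :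
    mk l hl * mk m hm = mk (m ++ l) (hm.append hl) := rfl

theorem mk_eq_one {l : List V} {hl : X.IsPath v l v} : mk l hl = 1 ↔ X.Htpy v l [] := mk_eq_mk

noncomputable instance : Group (X.EdgeGroup v) :=
  groupOfIsUnit fun g => by
    obtain ⟨l, hl, rfl⟩ := exists_mk g
    obtain ⟨m, hm, h1, h2⟩ := hl.exists_inv
    exact ⟨⟨mk l hl, mk m hm, mk_eq_one.2 h2, mk_eq_one.2 h1⟩, rfl⟩

/-- The homomorphism induced by a simplicial map. -/
def map {f : W → V} {Z : PreAbstractSimplicialComplex W} (hf : IsSimplicial f Z X) (w : W) :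
    Z.EdgeGroup w →* X.EdgeGroup (f w) where
  toFun := Quotient.map (fun l => ⟨l.1.map f, l.2.map hf⟩) fun _ _ h => Htpy.map hf h
  map_one' := rfl
  map_mul' := by
    rintro ⟨l⟩ ⟨m⟩
    exact mk_eq_mk.2 (by rw [List.map_append]; exact .refl)

/-- The homomorphism induced by the inclusion of a subcomplex. -/
def incl (h : X ≤ Y) (v : V) : X.EdgeGroup v →* Y.EdgeGroup v where
  toFun := Quotient.map (fun l => ⟨l.1, l.2.mono h⟩) fun _ _ h' => Htpy.mono h' h
  map_one' := rfl
  map_mul' := by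
    rintro ⟨l⟩ ⟨m⟩
    rfl

theorem map_incl {f : V → W} {K L : PreAbstractSimplicialComplex V}
    {X : PreAbstractSimplicialComplex W} (hL : IsSimplicial f L X) (hK : IsSimplicial f K X)
    (h : K ≤ L) (v : V) (g : K.EdgeGroup v) : map hL v (incl h v g) = map hK v g := by
  obtain ⟨l, hl, rfl⟩ := exists_mk g
  rfl

theorem incl_incl (h : X ≤ Y) (h' : Y ≤ Z) (g : X.EdgeGroup v) :
    incl h' v (incl h v g) = incl (h.trans h') v g := by
  obtain ⟨l, hl, rfl⟩ := exists_mk g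
  rfl

end EdgeGroup

end PreAbstractSimplicialComplex

/-! ### Finite diagrams over `X` realizing a presentation -/

namespace PreAbstractSimplicialComplex

variable {V M : Type*} [DecidableEq V] [DecidableEq M]

/-- The simplex spanned by `t`, with all its faces. -/
def fullSimplex (t : Finset M) : PreAbstractSimplicialComplex M where
  faces := {s | s.Nonempty ∧ s ⊆ t}
  isRelLowerSet_faces := fun _ hs => ⟨hs.1, fun _ hu hne => ⟨hne, hu.trans hs.2⟩⟩

/-- A finite connected complex `K` with a base vertex `o` and a simplicial map to `X`. -/
structure IsDiagram (X : PreAbstractSimplicialComplex V) (f : M → V) (o : M)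
    (K : PreAbstractSimplicialComplex M) : Prop where
  finite : {p | {p} ∈ K}.Finite
  isSimplicial : IsSimplicial f K X
  base_mem : {o} ∈ K
  connected : ∀ p, {p} ∈ K → ∃ l, K.IsPath o l p

/-- `L` is a diagram containing `K` such that every edge loop of `L` is homotopic to one of `K`. -/
structure IsExtension (X : PreAbstractSimplicialComplex V) (f : M → V) (o : M)
    (K L : PreAbstractSimplicialComplex M) : Prop where
  isDiagram : IsDiagram X f o L
  le : K ≤ L
  surjective : Function.Surjective (EdgeGroup.incl le o)

variable {X : PreAbstractSimplicialComplex V} {f : M → V} {o : M}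
  {K L : PreAbstractSimplicialComplex M}

theorem IsDiagram.isExtension (hK : IsDiagram X f o K) : IsExtension X f o K K :=
  ⟨hK, le_rfl, fun g => ⟨g, by obtain ⟨l, hl, rfl⟩ := g.exists_mk; rfl⟩⟩

theorem IsExtension.trans {N : PreAbstractSimplicialComplex M} (h : IsExtension X f o K L)
    (h' : IsExtension X f o L N) : IsExtension X f o K N := by
  refine ⟨h'.isDiagram, h.le.trans h'.le, fun g => ?_⟩
  obtain ⟨g, rfl⟩ := h'.surjective g
  obtain ⟨g, rfl⟩ := h.surjective g
  exact ⟨g, (EdgeGroup.incl_incl _ _ g).symm⟩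

/-- If every edge of `L` can be deformed, by moving each vertex `p` along the path `σ p`, into a
path of `K`, then so can every path of `L`. -/
theorem exists_path_of_edges (r : M → M) (σ : M → List M)
    (he : ∀ p q, {p, q} ∈ L →
      ∃ m, K.IsPath (r p) m (r q) ∧ L.Htpy (r p) (σ p ++ [q]) (m ++ σ q)) (hKL : K ≤ L) {p q : M}
    {l : List M} (hl : L.IsPath p l q) :
    ∃ m, K.IsPath (r p) m (r q) ∧ L.Htpy (r p) (σ p ++ l) (m ++ σ q) := by
  induction l generalizing p with
  | nil =>
    obtain rfl : p = q := hl
    exact ⟨[], rfl, by simpa using .refl⟩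
  | cons c l ih =>
    obtain ⟨m, hm, h1⟩ := he p c hl.1
    obtain ⟨m', hm', h2⟩ := ih hl.2
    refine ⟨m ++ m', hm.append hm', ?_⟩
    have h3 := h1.append_right l
    have h4 := h2.append_left (hm.mono hKL)
    simp only [List.append_assoc, List.cons_append, List.nil_append] at h3 h4 ⊢
    exact h3.trans h4

/-- The base vertex is fixed and its track is empty, so the deformation of a loop is again a loop at
`o`, homotopic to the original one. -/
theorem surjective_incl_of_edges (r : M → M) (σ : M → List M)
    (he : ∀ p q, {p, q} ∈ L →
      ∃ m, K.IsPath (r p) m (r q) ∧ L.Htpy (r p) (σ p ++ [q]) (m ++ σ q)) (hKL : K ≤ L)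
    (hr : r o = o) (hσ : σ o = []) : Function.Surjective (EdgeGroup.incl hKL o) := by
  intro g
  obtain ⟨l, hl, rfl⟩ := g.exists_mk
  obtain ⟨m, hm, h⟩ := exists_path_of_edges r σ he hKL hl
  rw [hr] at hm h
  rw [hσ] at h
  exact ⟨EdgeGroup.mk m hm, EdgeGroup.mk_eq_mk.2 (by simpa using h.symm)⟩

/-- Attaching a triangle along two of its edges. -/
theorem IsDiagram.attach_triangle (hK : IsDiagram X f o K) {a b c : M} (hab : {a, b} ∈ K)
    (hbc : {b, c} ∈ K) (hX : {f a, f b, f c} ∈ X) :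
    IsExtension X f o K (K ⊔ fullSimplex {a, b, c}) := by
  have hle : K ≤ K ⊔ fullSimplex {a, b, c} := le_sup_left
  have hb : ∀ p ∈ ({a, b, c} : Finset M), {p, b} ∈ K := by
    intro p hp
    simp only [Finset.mem_insert, Finset.mem_singleton] at hp
    rcases hp with rfl | rfl | rfl
    · exact hab
    · exact K.pair_mem hbc (by simp) (by simp)
    · exact pair_comm hbc
  have hsub : ∀ s : Finset M, s.Nonempty → s ⊆ {a, b, c} → s ∈ K ⊔ fullSimplex {a, b, c} :=
    fun s h1 h2 => Or.inr ⟨h1, h2⟩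
  have hvert : ∀ p, {p} ∈ K ⊔ fullSimplex {a, b, c} → {p} ∈ K := by
    rintro p (h | h)
    · exact h
    · exact K.singleton_mem (hb p (by simpa using h.2)) (by simp)
  refine ⟨⟨hK.finite.subset hvert, ?_, hle hK.base_mem, fun p hp => ?_⟩, hle, ?_⟩
  · rintro s (hs | hs)
    · exact hK.isSimplicial s hs
    · refine X.mem_of_subset hX ?_ (hs.1.image f)
      intro x hx
      obtain ⟨y, hy, rfl⟩ := Finset.mem_image.1 hx
      have := hs.2 hy
      simp only [Finset.mem_insert, Finset.mem_singleton] at this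
      rcases this with rfl | rfl | rfl <;> simp
  · obtain ⟨l, hl⟩ := hK.connected p (hvert p hp)
    exact ⟨l, hl.mono hle⟩
  · refine surjective_incl_of_edges id (fun _ => []) ?_ hle rfl rfl
    rintro p q (h | h)
    · exact ⟨[q], ⟨h, rfl⟩, by simpa using .refl⟩
    · have hp : p ∈ ({a, b, c} : Finset M) := h.2 (by simp)
      have hq : q ∈ ({a, b, c} : Finset M) := h.2 (by simp)
      -- Every vertex of the triangle is joined to `b` in `K`, so an edge of the triangle can be
      -- pushed to a path through `b`.
      refine ⟨[b, q], ⟨hb p hp, pair_comm (hb q hq), rfl⟩, ?_⟩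
      refine Htpy.symm (Htpy.tri (hsub _ (by simp) ?_))
      intro x hx
      simp only [id, Finset.mem_insert, Finset.mem_singleton] at hx
      rcases hx with rfl | rfl | rfl
      · exact hp
      · simp
      · exact hq

/-- Attaching a triangle with a new vertex `b` along an edge. -/
theorem IsDiagram.attach_vertex (hK : IsDiagram X f o K) {a b c : M} (hac : {a, c} ∈ K)
    (hb : {b} ∉ K) (hX : {f a, f b, f c} ∈ X) :
    IsExtension X f o K (K ⊔ fullSimplex {a, b, c}) := by
  have hle : K ≤ K ⊔ fullSimplex {a, b, c} := le_sup_left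
  have hsub : ∀ s : Finset M, s.Nonempty → s ⊆ {a, b, c} → s ∈ K ⊔ fullSimplex {a, b, c} :=
    fun s h1 h2 => Or.inr ⟨h1, h2⟩
  have ha : {a} ∈ K := K.singleton_mem hac (by simp)
  have hc : {c} ∈ K := K.singleton_mem hac (by simp)
  have hvert : ∀ p, {p} ∈ K ⊔ fullSimplex {a, b, c} → {p} ∈ K ∨ p = b := by
    rintro p (h | h)
    · exact Or.inl h
    · have : p ∈ ({a, b, c} : Finset M) := by simpa using h.2
      simp only [Finset.mem_insert, Finset.mem_singleton] at this
      rcases this with rfl | rfl | rfl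
      · exact Or.inl ha
      · exact Or.inr rfl
      · exact Or.inl hc
  refine ⟨⟨?_, ?_, hle hK.base_mem, fun p hp => ?_⟩, hle, ?_⟩
  · exact (hK.finite.union (Set.finite_singleton b)).subset hvert
  · rintro s (hs | hs)
    · exact hK.isSimplicial s hs
    · refine X.mem_of_subset hX ?_ (hs.1.image f)
      intro x hx
      obtain ⟨y, hy, rfl⟩ := Finset.mem_image.1 hx
      have := hs.2 hy
      simp only [Finset.mem_insert, Finset.mem_singleton] at this
      rcases this with rfl | rfl | rfl <;> simp
  · rcases hvert p hp with h | rfl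
    · obtain ⟨l, hl⟩ := hK.connected p h
      exact ⟨l, hl.mono hle⟩
    · obtain ⟨l, hl⟩ := hK.connected a ha
      exact ⟨l ++ [p], (hl.mono hle).append ⟨hsub _ (by simp) (by grind), rfl⟩⟩
  · have hne : ∀ p, {p} ∈ K → p ≠ b := by
      rintro p hp rfl
      exact hb hp
    -- The new vertex `b` is retracted to `a`; the track `[b]` is the edge from `a` back to `b`.
    refine surjective_incl_of_edges (fun p => if p = b then a else p)
      (fun p => if p = b then [b] else []) ?_ hle (if_neg (hne o hK.base_mem))
      (if_neg (hne o hK.base_mem))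
    have hac' : ∀ p q, p ∈ ({a, c} : Finset M) → q ∈ ({a, c} : Finset M) → {p, q} ∈ K :=
      fun p q hp hq => K.pair_mem hac hp hq
    have hnew : ∀ p, p ≠ b → {p, b} ∈ K ⊔ fullSimplex {a, b, c} → p ∈ ({a, c} : Finset M) := by
      rintro p hpb (h | h)
      · exact absurd (K.singleton_mem h (by simp)) hb
      · have : p ∈ ({a, b, c} : Finset M) := h.2 (by simp)
        grind
    intro p q hpq
    by_cases hp : p = b <;> by_cases hq : q = b
    · subst hp hq
      refine ⟨[], rfl, ?_⟩
      simpa using Htpy.tri (hsub _ (by simp) (by grind))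
    · subst hp
      have hq' := hnew q hq (pair_comm hpq)
      refine ⟨[q], ?_, ?_⟩
      · simp only [if_true, if_neg hq]
        exact ⟨hac' a q (by simp) hq', rfl⟩
      · simp only [if_true, if_neg hq]
        exact Htpy.tri (hsub _ (by simp) (by grind))
    · subst hq
      have hp' := hnew p hp hpq
      refine ⟨[a], ?_, ?_⟩
      · simp only [if_true, if_neg hp]
        exact ⟨hac' p a hp' (by simp), rfl⟩
      · simp only [if_true, if_neg hp]
        exact Htpy.symm (Htpy.tri (hsub _ (by simp) (by grind)))
    · refine ⟨[q], ?_, ?_⟩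
      · simp only [if_neg hp, if_neg hq]
        refine ⟨?_, rfl⟩
        rcases hpq with h | h
        · exact h
        · have h1 : p ∈ ({a, b, c} : Finset M) := h.2 (by simp)
          have h2 : q ∈ ({a, b, c} : Finset M) := h.2 (by simp)
          exact hac' p q (by grind) (by grind)
      · simp only [if_neg hp, if_neg hq]
        exact .refl

theorem IsDiagram.exists_fresh (hK : IsDiagram X f o K) (hf : ∀ v, (f ⁻¹' {v}).Infinite) (v : V) :
    ∃ b, {b} ∉ K ∧ f b = v := by
  obtain ⟨b, hb, hb'⟩ := ((hf v).sdiff hK.finite).nonempty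
  exact ⟨b, hb', hb⟩

/-- The lift of a path with image `w` to a diagram `K` can be deformed, in an extension of `K`, to
one with image `w'`. -/
def Liftable (X : PreAbstractSimplicialComplex V) (f : M → V) (o : M) (a : V)
    (w w' : List V) : Prop :=
  ∀ K, IsDiagram X f o K → ∀ p q l, f p = a → K.IsPath p l q → l.map f = w →
    ∃ L, IsExtension X f o K L ∧ ∃ l', L.IsPath p l' q ∧ l'.map f = w' ∧ L.Htpy p l l'

theorem Liftable.refl {a : V} {w : List V} : Liftable X f o a w w :=
  fun K hK _ _ l _ hl hw => ⟨K, hK.isExtension, l, hl, hw, .refl⟩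

theorem Liftable.trans {a : V} {w w' w'' : List V} (h : Liftable X f o a w w')
    (h' : Liftable X f o a w' w'') : Liftable X f o a w w'' := by
  intro K hK p q l hp hl hw
  obtain ⟨L, hL, l1, hl1, hw1, h1⟩ := h K hK p q l hp hl hw
  obtain ⟨N, hN, l2, hl2, hw2, h2⟩ := h' L hL.isDiagram p q l1 hp hl1 hw1
  exact ⟨N, hL.trans hN, l2, hl2, hw2, (h1.mono hN.le).trans h2⟩

theorem Liftable.cons {a b : V} {w w' : List V} (h : Liftable X f o b w w') :
    Liftable X f o a (b :: w) (b :: w') := by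
  intro K hK p q l hp hl hw
  obtain ⟨r, l, rfl, hr, hw⟩ := List.map_eq_cons_iff.1 hw
  obtain ⟨L, hL, l1, hl1, hw1, h1⟩ := h K hK r q l hr hl.2 hw
  exact ⟨L, hL, r :: l1, ⟨hL.le hl.1, hl1⟩, by simp [hr, hw1], h1.cons⟩

theorem Liftable.remove {a b c : V} {w : List V} (hX : {a, b, c} ∈ X) :
    Liftable X f o a (b :: c :: w) (c :: w) := by
  intro K hK p q l hp hl hw
  obtain ⟨r, l, rfl, hr, hw⟩ := List.map_eq_cons_iff.1 hw
  obtain ⟨s, l, rfl, hs, hw⟩ := List.map_eq_cons_iff.1 hw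
  have hL := hK.attach_triangle (a := p) (b := r) (c := s) hl.1 hl.2.1 (by rwa [hp, hr, hs])
  have hpr : {p, r, s} ∈ K ⊔ fullSimplex {p, r, s} := Or.inr ⟨by simp, by simp⟩
  exact ⟨_, hL, s :: l, ⟨(K ⊔ _).pair_mem hpr (by simp) (by simp), hl.2.2.mono hL.le⟩,
    by simp [hs, hw], .tri hpr⟩

/-- The inserted vertex is chosen outside the diagram: a triangle glued along one edge with a fresh
apex creates no new loops, whereas an old vertex over `b` might. -/
theorem Liftable.insert (hf : ∀ v, (f ⁻¹' {v}).Infinite) {a b c : V} {w : List V}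
    (hX : {a, b, c} ∈ X) : Liftable X f o a (c :: w) (b :: c :: w) := by
  intro K hK p q l hp hl hw
  obtain ⟨s, l, rfl, hs, hw⟩ := List.map_eq_cons_iff.1 hw
  obtain ⟨r, hrK, hr⟩ := hK.exists_fresh hf b
  have hL := hK.attach_vertex (a := p) (b := r) (c := s) hl.1 hrK (by rwa [hp, hr, hs])
  have hpr : {p, r, s} ∈ K ⊔ fullSimplex {p, r, s} := Or.inr ⟨by simp, by simp⟩
  exact ⟨_, hL, r :: s :: l, ⟨(K ⊔ _).pair_mem hpr (by simp) (by simp),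
    (K ⊔ _).pair_mem hpr (by simp) (by simp), hl.2.mono hL.le⟩, by simp [hr, hs, hw],
    Htpy.symm (.tri hpr)⟩

/-- A lift projects to an edge path of `X`, so words which are not edge paths have nothing to lift.
-/
theorem Liftable.of_isPath {a : V} {w w' : List V}
    (h : ∀ b, X.IsPath a w b → Liftable X f o a w w') : Liftable X f o a w w' := by
  intro K hK p q l hp hl hw
  subst hp hw
  exact h _ (hl.map hK.isSimplicial) K hK p q l rfl hl rfl

/-- The final letter `z` keeps the end of the lift in place. Deleting a repeated vertex at the end
of a word could change the endpoint of its lift; with a letter `d` always following, this move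
becomes the triangle move for the degenerate triangle `a, a, d`. -/
theorem Step.liftable (hf : ∀ v, (f ⁻¹' {v}).Infinite) {a : V} {w w' : List V}
    (h : X.Step a w w') (z : V) : Liftable X f o a (w ++ [z]) (w' ++ [z]) ∧
      Liftable X f o a (w' ++ [z]) (w ++ [z]) := by
  induction h with
  | @stay a w h =>
    obtain ⟨d, t, e⟩ : ∃ d t, w ++ [z] = d :: t := by cases w <;> simp
    rw [List.cons_append, e]
    refine ⟨.of_isPath fun b hb => .remove ?_, .of_isPath fun b hb => .insert hf ?_⟩
    · simpa using hb.2.1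
    · simpa using hb.1
  | tri h => exact ⟨.remove h, .insert hf h⟩
  | cons _ ih => exact ⟨ih.1.cons, ih.2.cons⟩

theorem Htpy.liftable (hf : ∀ v, (f ⁻¹' {v}).Infinite) {a : V} {w w' : List V}
    (h : X.Htpy a w w') (z : V) : Liftable X f o a (w ++ [z]) (w' ++ [z]) ∧
      Liftable X f o a (w' ++ [z]) (w ++ [z]) := by
  induction h with
  | rel _ _ h => exact h.liftable hf z
  | refl _ => exact ⟨.refl, .refl⟩
  | symm _ _ _ ih => exact ⟨ih.2, ih.1⟩
  | trans _ _ _ _ _ ih ih' => exact ⟨ih.1.trans ih'.1, ih'.2.trans ih.2⟩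

/-- A loop of a diagram which is null-homotopic in `X` becomes null-homotopic in an extension. -/
theorem IsDiagram.exists_extension_incl_eq_one (hK : IsDiagram X f o K)
    (hf : ∀ v, (f ⁻¹' {v}).Infinite) (u : K.EdgeGroup o)
    (hu : EdgeGroup.map hK.isSimplicial o u = 1) :
    ∃ (L : _) (hL : IsExtension X f o K L), EdgeGroup.incl hL.le o u = 1 := by
  obtain ⟨l, hl, rfl⟩ := u.exists_mk
  have h := EdgeGroup.mk_eq_one.1 hu
  have hoo : {o, o} ∈ K := by simpa using hK.base_mem
  obtain ⟨L, hL, l', hl', hw, hh⟩ := (h.liftable (o := o) hf (f o)).1 K hK o o (l ++ [o]) rfl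
    (hl.append ⟨hoo, rfl⟩) (by simp)
  refine ⟨L, hL, EdgeGroup.mk_eq_one.2 ?_⟩
  -- The deformed lift projects to the single letter `f o` and still ends at `o`, so it is the
  -- constant step at `o`.
  obtain ⟨q, rfl⟩ : ∃ q, l' = [q] := List.length_eq_one_iff.1 (by simpa using congrArg List.length hw)
  obtain rfl : q = o := hl'.2
  have h1 : L.Htpy q (l ++ [q]) (l ++ []) :=
    Htpy.append_left (hl.mono hL.le) (.stay hL.isDiagram.base_mem)
  rw [List.append_nil] at h1
  exact h1.symm.trans (hh.trans (.stay hL.isDiagram.base_mem))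

theorem IsDiagram.exists_extension_arc (hK : IsDiagram X f o K)
    (hf : ∀ v, (f ⁻¹' {v}).Infinite) {p : M} (hp : {p} ∈ K) {w : List V} {v : V}
    (hw : X.IsPath (f p) w v) :
    ∃ L, IsExtension X f o K L ∧ ∃ l q, L.IsPath p l q ∧ l.map f = w := by
  induction w generalizing K p with
  | nil => exact ⟨K, hK.isExtension, [], p, rfl, rfl⟩
  | cons c w ih =>
    obtain ⟨b, hb, hbc⟩ := hK.exists_fresh hf c
    subst hbc
    -- With `a = c = p` the attached triangle degenerates to an edge with a free end.
    have hL := hK.attach_vertex (a := p) (b := b) (c := p) (by simpa using hp) hb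
      (X.mem_of_subset hw.1 (by grind) (by simp))
    have hpb : {p, b, p} ∈ K ⊔ fullSimplex {p, b, p} := Or.inr ⟨by simp, by simp⟩
    obtain ⟨L, hL', l, q, hl, hlw⟩ := ih hL.isDiagram ((K ⊔ _).singleton_mem hpb (by simp)) hw.2
    exact ⟨L, hL.trans hL', b :: l, q, ⟨hL'.le ((K ⊔ _).pair_mem hpb (by simp) (by simp)), hl⟩,
      by simp [hlw]⟩

/-- Attaching an edge which closes a path `l` up to a loop adds one generator. -/
theorem eq_top_of_attach_edge {q : M} {l : List M} (hl : K.IsPath o l q)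
    (hl' : (K ⊔ fullSimplex {q, o}).IsPath o (l ++ [o]) o)
    (A : Subgroup ((K ⊔ fullSimplex {q, o}).EdgeGroup o))
    (hA : (EdgeGroup.incl (le_sup_left : K ≤ K ⊔ fullSimplex {q, o}) o).range ≤ A)
    (he : EdgeGroup.mk (l ++ [o]) hl' ∈ A) (ho : {o} ∈ K) : A = ⊤ := by
  have hle : K ≤ K ⊔ fullSimplex {q, o} := le_sup_left
  have hq : {q} ∈ K := hl.end_mem ho
  have hloop : ∀ s (hs : K.IsPath o s o), EdgeGroup.mk s (hs.mono hle) ∈ A :=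
    fun s hs => hA ⟨EdgeGroup.mk s hs, rfl⟩
  have hqo : {q, o} ∈ K ⊔ fullSimplex {q, o} := Or.inr ⟨by simp, by simp⟩
  obtain ⟨l', hl1, hl2, hl3⟩ := hl.exists_inv
  have hll := hl.mono hle
  have hl1' := hl1.mono hle
  have hl2' := hl2.mono hle
  have hl3' := hl3.mono hle
  have hsplit : ∀ s t (hs : (K ⊔ fullSimplex {q, o}).IsPath o s o)
      (ht : (K ⊔ fullSimplex {q, o}).IsPath o t o), EdgeGroup.mk s hs ∈ A →
      EdgeGroup.mk t ht ∈ A → EdgeGroup.mk (s ++ t) (hs.append ht) ∈ A :=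
    fun s t hs ht h1 h2 => A.mul_mem h2 h1
  have hcongr : ∀ s t (hs : (K ⊔ fullSimplex {q, o}).IsPath o s o)
      (ht : (K ⊔ fullSimplex {q, o}).IsPath o t o), (K ⊔ fullSimplex {q, o}).Htpy o s t →
      EdgeGroup.mk s hs ∈ A → EdgeGroup.mk t ht ∈ A := by
    intro s t hs ht h h'
    rwa [← EdgeGroup.mk_eq_mk.2 h]
  have he' : ∃ h, EdgeGroup.mk (q :: l') h ∈ A := by
    refine ⟨⟨pair_comm hqo, hl1'⟩, ?_⟩
    have : EdgeGroup.mk (q :: l') ⟨pair_comm hqo, hl1'⟩ * EdgeGroup.mk (l ++ [o]) hl' = 1 := by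
      refine EdgeGroup.mk_eq_one.2 ?_
      have h1 : (K ⊔ fullSimplex {q, o}).Htpy o (l ++ (o :: q :: l')) (l ++ l') :=
        Htpy.append_left hll (.back_forth hqo)
      simpa using h1.trans hl2'
    rw [eq_inv_of_mul_eq_one_left this]
    exact A.inv_mem he
  obtain ⟨hq', he'⟩ := he'
  -- Induction on the part `m` of the loop not yet read, with the part `s` already read lying in
  -- `K`. At each passage over the new edge the loop is cut into a loop of `K`, the new generator or
  -- its inverse, and a shorter remainder; `l` and `l'` connect the pieces to the base vertex.
  have key : ∀ m p, (K ⊔ fullSimplex {q, o}).IsPath p m o → ∀ s, K.IsPath o s p →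
      ∀ h, EdgeGroup.mk (s ++ m) h ∈ A := by
    intro m
    induction m with
    | nil =>
      intro p hp s hs h
      obtain rfl : p = o := hp
      simpa using hloop s hs
    | cons c m ih =>
      intro p hp s hs h
      have hK : {p, c} ∈ K → EdgeGroup.mk (s ++ c :: m) h ∈ A := by
        intro hpc
        have := ih c hp.2 (s ++ [c]) (hs.append ⟨hpc, rfl⟩) (by simpa using h)
        simpa using this
      rcases hp.1 with hpc | hpc
      · exact hK hpc
      have hp' : p ∈ ({q, o} : Finset M) := hpc.2 (by simp)
      have hc' : c ∈ ({q, o} : Finset M) := hpc.2 (by simp)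
      simp only [Finset.mem_insert, Finset.mem_singleton] at hp' hc'
      have hsL := hs.mono hle
      rcases hp' with rfl | rfl <;> rcases hc' with rfl | rfl
      · exact hK (by simpa using hq)
      · have h1 := hsplit _ _ _ _ (hsplit _ _ _ _ (hloop (s ++ l') (hs.append hl1)) he)
          (ih c hp.2 [] rfl hp.2)
        refine hcongr _ _ _ _ ?_ h1
        have h2 : (K ⊔ fullSimplex {p, c}).Htpy c (s ++ ((l' ++ l) ++ c :: m))
            (s ++ ([] ++ c :: m)) := Htpy.append_left hsL (hl3'.append_right _)
        simpa using h2
      · have h1 := hsplit _ _ _ _ (hsplit _ _ _ _ (hloop s hs) he')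
          (ih c hp.2 l hl (hll.append hp.2))
        refine hcongr _ _ _ _ ?_ h1
        have h2 : (K ⊔ fullSimplex {c, p}).Htpy p (s ++ (c :: ((l' ++ l) ++ m)))
            (s ++ (c :: ([] ++ m))) := Htpy.append_left hsL (hl3'.append_right _).cons
        simpa using h2
      · exact hK (by simpa using ho)
  refine eq_top_iff.2 fun g _ => ?_
  obtain ⟨m, hm, rfl⟩ := g.exists_mk
  exact key m o hm [] rfl hm

/-- A loop representing `g` is drawn as an arc from `o` on fresh vertices. Its end `q` lies over `f
o`, so it can be joined to `o` by an edge which `f` collapses to a vertex. -/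
theorem IsDiagram.exists_attach_loop (hK : IsDiagram X f o K)
    (hf : ∀ v, (f ⁻¹' {v}).Infinite) (g : X.EdgeGroup (f o)) :
    ∃ (L : _) (hL : IsDiagram X f o L) (hKL : K ≤ L) (e : L.EdgeGroup o),
      EdgeGroup.map hL.isSimplicial o e = g ∧
        ∀ A : Subgroup (L.EdgeGroup o), (EdgeGroup.incl hKL o).range ≤ A → e ∈ A → A = ⊤ := by
  obtain ⟨w, hw, rfl⟩ := g.exists_mk
  obtain ⟨N, hN, l, q, hl, rfl⟩ := hK.exists_extension_arc hf hK.base_mem hw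
  have hNd := hN.isDiagram
  have hfq : f q = f o := (hl.map hNd.isSimplicial).end_unique hw
  have hle : N ≤ N ⊔ fullSimplex {q, o} := le_sup_left
  have hq : {q} ∈ N := hl.end_mem hNd.base_mem
  have hoX : {f o} ∈ X := hNd.isSimplicial.singleton hNd.base_mem
  have hqo : {q, o} ∈ N ⊔ fullSimplex {q, o} := Or.inr ⟨by simp, by simp⟩
  have hL : IsDiagram X f o (N ⊔ fullSimplex {q, o}) := by
    have hvert : ∀ p, {p} ∈ N ⊔ fullSimplex {q, o} → {p} ∈ N := by
      rintro p (h | h)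
      · exact h
      · have : p ∈ ({q, o} : Finset M) := by simpa using h.2
        simp only [Finset.mem_insert, Finset.mem_singleton] at this
        rcases this with rfl | rfl
        · exact hq
        · exact hNd.base_mem
    refine ⟨hNd.finite.subset hvert, ?_, hle hNd.base_mem, fun p hp => ?_⟩
    · rintro s (hs | hs)
      · exact hNd.isSimplicial s hs
      · refine X.mem_of_subset hoX ?_ (hs.1.image f)
        intro x hx
        obtain ⟨y, hy, rfl⟩ := Finset.mem_image.1 hx
        have := hs.2 hy
        simp only [Finset.mem_insert, Finset.mem_singleton] at this
        rcases this with rfl | rfl <;> simp [hfq]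
    · obtain ⟨s, hs⟩ := hNd.connected p (hvert p hp)
      exact ⟨s, hs.mono hle⟩
  have hlo : (N ⊔ fullSimplex {q, o}).IsPath o (l ++ [o]) o := (hl.mono hle).append ⟨hqo, rfl⟩
  refine ⟨_, hL, hN.le.trans hle, EdgeGroup.mk (l ++ [o]) hlo, ?_, fun A hA he => ?_⟩
  · refine EdgeGroup.mk_eq_mk.2 ?_
    have h1 : X.Htpy (f o) (l.map f ++ [f o]) (l.map f ++ []) :=
      Htpy.append_left hw (.stay hoX)
    simpa using h1
  · refine eq_top_of_attach_edge hl hlo A ?_ he hNd.base_mem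
    rintro _ ⟨u, rfl⟩
    obtain ⟨u, rfl⟩ := hN.surjective u
    exact hA ⟨u, (EdgeGroup.incl_incl _ _ _).symm⟩

theorem exists_diagram_of_generators (hf : ∀ v, (f ⁻¹' {v}).Infinite) (ho : {f o} ∈ X) (n : ℕ)
    (g : Fin n → X.EdgeGroup (f o)) :
    ∃ (K : _) (hK : IsDiagram X f o K) (e : Fin n → K.EdgeGroup o),
      (∀ i, EdgeGroup.map hK.isSimplicial o (e i) = g i) ∧ Subgroup.closure (Set.range e) = ⊤ := by
  induction n with
  | zero =>
    have hoK : {o} ∈ fullSimplex {o} := ⟨by simp, by simp⟩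
    have hK : IsDiagram X f o (fullSimplex {o}) := by
      refine ⟨(Set.finite_singleton o).subset ?_, ?_, hoK, ?_⟩
      · rintro p ⟨-, hp⟩
        simpa using hp
      · rintro s ⟨h1, h2⟩
        refine X.mem_of_subset ho ?_ (h1.image f)
        intro x hx
        obtain ⟨y, hy, rfl⟩ := Finset.mem_image.1 hx
        simp [Finset.mem_singleton.1 (h2 hy)]
      · rintro p ⟨-, hp⟩
        obtain rfl : p = o := by simpa using hp
        exact ⟨[], rfl⟩
    refine ⟨_, hK, Fin.elim0, fun i => i.elim0, eq_top_iff.2 fun u hu => ?_⟩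
    obtain ⟨l, hl, rfl⟩ := u.exists_mk
    have : (fullSimplex {o}).Htpy o l [] := by
      clear hK hu
      induction l with
      | nil => exact .refl
      | cons c l ih =>
        obtain rfl : c = o := by
          have : c ∈ ({o} : Finset M) := hl.1.2 (by simp)
          simpa using this
        exact (Htpy.stay hoK).trans (ih hl.2)
    rw [EdgeGroup.mk_eq_one.2 this]
    exact Subgroup.one_mem _
  | succ n ih =>
    obtain ⟨K, hK, e, he, htop⟩ := ih fun i => g i.succ
    obtain ⟨L, hL, hKL, u, hu, hA⟩ := hK.exists_attach_loop hf (g 0)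
    refine ⟨L, hL, Fin.cons u fun i => EdgeGroup.incl hKL o (e i), fun i => ?_, ?_⟩
    · refine Fin.cases ?_ (fun i => ?_) i
      · exact hu
      · exact (EdgeGroup.map_incl hL.isSimplicial hK.isSimplicial hKL o (e i)).trans (he i)
    · refine hA _ ?_ (Subgroup.subset_closure ⟨0, rfl⟩)
      rw [MonoidHom.range_eq_map, ← htop, MonoidHom.map_closure, Subgroup.closure_le]
      rintro _ ⟨_, ⟨i, rfl⟩, rfl⟩
      exact Subgroup.subset_closure ⟨i.succ, rfl⟩

/-- Every finitely presented subgroup of the edge path group of `X` is realized by a diagram. -/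
theorem exists_diagram_of_presentation (hf : ∀ v, (f ⁻¹' {v}).Infinite) (ho : {f o} ∈ X) {n : ℕ}
    (φ : FreeGroup (Fin n) →* X.EdgeGroup (f o)) (hφ : φ.ker.IsFinitelyNormallyGenerated) :
    ∃ (K : _) (hK : IsDiagram X f o K) (ψ : FreeGroup (Fin n) →* K.EdgeGroup o),
      Function.Surjective ψ ∧ (∀ w, EdgeGroup.map hK.isSimplicial o (ψ w) = φ w) ∧
        φ.ker ≤ ψ.ker := by
  obtain ⟨R, hR, hRφ⟩ := hφ
  have hRker : ∀ r ∈ R, φ r = 1 := fun r hr => by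
    have : r ∈ φ.ker := hRφ ▸ Subgroup.subset_normalClosure hr
    exact this
  -- The relators are killed one at a time; each extension keeps the map from the free group
  -- surjective because it creates no new loops up to homotopy.
  have key : ∀ T : Finset (FreeGroup (Fin n)), (∀ r ∈ T, φ r = 1) →
      ∃ (K : _) (hK : IsDiagram X f o K) (ψ : FreeGroup (Fin n) →* K.EdgeGroup o),
        Function.Surjective ψ ∧ (∀ w, EdgeGroup.map hK.isSimplicial o (ψ w) = φ w) ∧
          ∀ r ∈ T, ψ r = 1 := by
    intro T
    induction T using Finset.induction_on with
    | empty =>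
      intro _
      obtain ⟨K, hK, e, he, htop⟩ := exists_diagram_of_generators hf ho n fun i => φ (.of i)
      refine ⟨K, hK, FreeGroup.lift e, ?_, fun w => ?_, by simp⟩
      · rw [← MonoidHom.range_eq_top, FreeGroup.range_lift_eq_closure, htop]
      · have : (EdgeGroup.map hK.isSimplicial o).comp (FreeGroup.lift e) = φ :=
          FreeGroup.ext_hom _ _ fun i => by simp [he]
        exact DFunLike.congr_fun this w
    | insert r T _ ih =>
      intro hT
      obtain ⟨K, hK, ψ, h1, h2, h3⟩ := ih fun r hr => hT r (Finset.mem_insert_of_mem hr)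
      obtain ⟨L, hL, h⟩ := hK.exists_extension_incl_eq_one hf (ψ r)
        ((h2 r).trans (hT r (Finset.mem_insert_self _ _)))
      refine ⟨L, hL.isDiagram, (EdgeGroup.incl hL.le o).comp ψ, hL.surjective.comp h1,
        fun w => ?_, fun s hs => ?_⟩
      · exact (EdgeGroup.map_incl hL.isDiagram.isSimplicial hK.isSimplicial hL.le o _).trans (h2 w)
      · rcases Finset.mem_insert.1 hs with rfl | hs
        · exact h
        · simp [h3 s hs]
  obtain ⟨K, hK, ψ, h1, h2, h3⟩ := key hR.toFinset fun r hr => hRker r (hR.mem_toFinset.1 hr)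
  refine ⟨K, hK, ψ, h1, h2, ?_⟩
  rw [← hRφ]
  exact Subgroup.normalClosure_le_normal fun r hr => h3 r (hR.mem_toFinset.2 hr)

/-! ### The minimal complex between a diagram and the preimage of `X` -/

/-- The simplices of `Y` all of whose edges are homotopic in `Y` to paths of `K`. -/
def homotopicSubcomplex (K Y : PreAbstractSimplicialComplex M) : PreAbstractSimplicialComplex M where
  faces := {s | s ∈ Y ∧ ∀ i ∈ s, ∀ j ∈ s, ∃ m, K.IsPath i m j ∧ Y.Htpy i m [j]}
  isRelLowerSet_faces := fun _ hs => ⟨Y.nonempty_of_mem hs.1, fun _ hu hne =>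
    ⟨Y.mem_of_subset hs.1 hu hne, fun i hi j hj => hs.2 i (hu hi) j (hu hj)⟩⟩

/-- If the edges `ab` and `bd` are homotopic to paths of `K` and `ad` is an edge of `Y`, then `a, b,
d` span a simplex of the flag complex `Y`, so `ad` is homotopic to the concatenated path. This is
the local pullback condition. -/
theorem HasConedPendants.homotopicSubcomplex {Y : PreAbstractSimplicialComplex M} {k : ℕ}
    (hY : Y.HasConedPendants k) (hKY : K ≤ Y) : (K.homotopicSubcomplex Y).HasConedPendants k := by
  refine hY.of_local_pullback ?_ id (fun a b h => h.1) ?_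
  · intro s hs h
    exact ⟨hY.isFlag s hs fun a ha b hb => (h a ha b hb).1,
      fun i hi j hj => (h i hi j hj).2 i (by simp) j (by simp)⟩
  · have trans : ∀ a b d, {a, b, d} ∈ Y → (∃ m, K.IsPath a m b ∧ Y.Htpy a m [b]) →
        (∃ m, K.IsPath b m d ∧ Y.Htpy b m [d]) → ∃ m, K.IsPath a m d ∧ Y.Htpy a m [d] := by
      rintro a b d h ⟨m, hm, h1⟩ ⟨m', hm', h2⟩
      have h3 := Htpy.append (hm.mono hKY) h1 h2
      exact ⟨m ++ m', hm.append hm', h3.trans (.tri h)⟩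
    intro a b d hab hbd had
    have habd := hY.isFlag.triple_mem hab.1 hbd.1 had
    have hdba : ({d, b, a} : Finset M) ∈ Y := by
      rwa [show ({d, b, a} : Finset M) = {a, b, d} by ext; simp; tauto]
    refine ⟨had, fun i hi j hj => ?_⟩
    simp only [Finset.mem_insert, Finset.mem_singleton] at hi hj
    rcases hi with rfl | rfl <;> rcases hj with rfl | rfl
    · exact hab.2 _ (by simp) _ (by simp)
    · exact trans i b j habd (hab.2 _ (by simp) _ (by simp)) (hbd.2 _ (by simp) _ (by simp))
    · exact trans i b j hdba (hbd.2 _ (by simp) _ (by simp)) (hab.2 _ (by simp) _ (by simp))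
    · exact hbd.2 _ (by simp) _ (by simp)

/-- The preimage of `X` under the vertex map `f`, on the vertices satisfying `S`. -/
def pullback (X : PreAbstractSimplicialComplex V) (f : M → V) (S : M → Prop) :
    PreAbstractSimplicialComplex M where
  faces := {s | s.image f ∈ X ∧ ∀ p ∈ s, S p}
  isRelLowerSet_faces := fun _ hs => ⟨Finset.image_nonempty.1 (X.nonempty_of_mem hs.1),
    fun _ hu hne => ⟨X.mem_of_subset hs.1 (Finset.image_subset_image hu) (hne.image f),
      fun p hp => hs.2 p (hu hp)⟩⟩

/-- Vertices in a common fibre are joined, so on the chosen vertices simplices are detected entirely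
in `X`. -/
theorem HasConedPendants.pullback {k : ℕ} (hX : X.HasConedPendants k) (S : M → Prop) :
    (X.pullback f S).HasConedPendants k := by
  refine hX.of_local_pullback ?_ f (fun a b h => by simpa [Finset.image_insert] using h.1) ?_
  · intro s hs h
    refine ⟨hX.isFlag _ (hs.image f) ?_, fun p hp => (h p hp p hp).2 p (by simp)⟩
    intro v hv w hw
    obtain ⟨p, hp, rfl⟩ := Finset.mem_image.1 hv
    obtain ⟨q, hq, rfl⟩ := Finset.mem_image.1 hw
    simpa [Finset.image_insert] using (h p hp q hq).1
  · intro a b d hab hbd had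
    refine ⟨by simpa [Finset.image_insert] using had, fun p hp => ?_⟩
    simp only [Finset.mem_insert, Finset.mem_singleton] at hp
    rcases hp with rfl | rfl
    · exact hab.2 _ (by simp)
    · exact hbd.2 _ (by simp)

/-- Between a diagram and the preimage of `X` there is a complex with coned pendants whose edge
loops are all homotopic to loops of the diagram. -/
theorem IsDiagram.exists_hasConedPendants (hK : IsDiagram X f o K) {k : ℕ}
    (hX : X.HasConedPendants k) :
    ∃ Y : PreAbstractSimplicialComplex M, Y.HasConedPendants k ∧ IsExtension X f o K Y := by
  obtain ⟨Y, ⟨hY, hKY, hYX, hYK⟩, hmin⟩ := exists_minimalFor_of_wellFoundedLT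
    (fun Y : PreAbstractSimplicialComplex M => Y.HasConedPendants k ∧ K ≤ Y ∧
      IsSimplicial f Y X ∧ ∀ p, {p} ∈ Y → {p} ∈ K)
    (fun Y => {e : M × M | {e.1, e.2} ∈ Y}.ncard)
    ⟨X.pullback f fun p => {p} ∈ K, hX.pullback _,
      fun s hs => ⟨hK.isSimplicial s hs, fun p hp => K.singleton_mem hs hp⟩,
      fun s hs => hs.1, fun p hp => hp.2 p (by simp)⟩
  refine ⟨Y, hY, ⟨hK.finite.subset hYK, hYX, hKY hK.base_mem, fun p hp => ?_⟩, hKY, ?_⟩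
  · obtain ⟨l, hl⟩ := hK.connected p (hYK p hp)
    exact ⟨l, hl.mono hKY⟩
  · have hfin : {e : M × M | {e.1, e.2} ∈ Y}.Finite :=
      (hK.finite.prod hK.finite).subset fun e he =>
        ⟨hYK _ (Y.singleton_mem he (by simp)), hYK _ (Y.singleton_mem he (by simp))⟩
    have hle : K.homotopicSubcomplex Y ≤ Y := fun s hs => hs.1
    have hsub : {e : M × M | {e.1, e.2} ∈ K.homotopicSubcomplex Y} ⊆
        {e : M × M | {e.1, e.2} ∈ Y} := fun e he => hle he
    have heq := Set.eq_of_subset_of_ncard_le hsub (hmin (j := K.homotopicSubcomplex Y)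
      ⟨hY.homotopicSubcomplex hKY, fun s hs => ⟨hKY hs, fun i hi j hj =>
        ⟨[j], ⟨K.pair_mem hs hi hj, rfl⟩, .refl⟩⟩, fun s hs => hYX s hs.1, fun p hp => hYK p hp.1⟩
      (Set.ncard_le_ncard hsub hfin)) hfin
    refine surjective_incl_of_edges id (fun _ => []) (fun p q hpq => ?_) hKY rfl rfl
    have : (p, q) ∈ {e : M × M | {e.1, e.2} ∈ K.homotopicSubcomplex Y} := heq ▸ hpq
    obtain ⟨m, hm, h⟩ := this.2 p (by simp) q (by simp)
    exact ⟨m, hm, by simpa using h.symm⟩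

/-- Every finitely presented subgroup of the edge path group is the edge path group of a finite
connected complex with coned pendants. -/
theorem HasConedPendants.exists_mulEquiv_edgeGroup {k : ℕ} (hX : X.HasConedPendants k)
    (hf : ∀ v, (f ⁻¹' {v}).Infinite) (ho : {f o} ∈ X) (H : Subgroup (X.EdgeGroup (f o)))
    (hH : Group.IsFinitelyPresented H) :
    ∃ Y : PreAbstractSimplicialComplex M, Y.HasConedPendants k ∧ IsDiagram X f o Y ∧
      Nonempty (H ≃* Y.EdgeGroup o) := by
  obtain ⟨n, φ, hφ, hker⟩ := hH
  have hker' : (H.subtype.comp φ).ker = φ.ker := by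
    ext w
    simp [MonoidHom.mem_ker]
  obtain ⟨K, hK, ψ, h1, h2, h3⟩ := exists_diagram_of_presentation hf ho (H.subtype.comp φ)
    (hker' ▸ hker)
  obtain ⟨Y, hY, hKY⟩ := hK.exists_hasConedPendants hX
  refine ⟨Y, hY, hKY.isDiagram, ⟨MulEquiv.symm ?_⟩⟩
  have hmap : ∀ w, EdgeGroup.map hKY.isDiagram.isSimplicial o (EdgeGroup.incl hKY.le o (ψ w)) =
      φ w := fun w => (EdgeGroup.map_incl _ hK.isSimplicial _ o _).trans (h2 w)
  have hsurj : ∀ g : Y.EdgeGroup o, ∃ w, EdgeGroup.incl hKY.le o (ψ w) = g := fun g => by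
    obtain ⟨u, rfl⟩ := hKY.surjective g
    obtain ⟨w, rfl⟩ := h1 u
    exact ⟨w, rfl⟩
  -- Every loop of `Y` comes from a word `w`; if it dies in `X`, then `w` is in the kernel of `φ`,
  -- hence trivial already in the diagram `K`.
  have hinj : Function.Injective (EdgeGroup.map hKY.isDiagram.isSimplicial o) := by
    refine (injective_iff_map_eq_one _).2 fun g hg => ?_
    obtain ⟨w, rfl⟩ := hsurj g
    have : ψ w = 1 := h3 ((hmap w).symm.trans hg)
    rw [this, map_one]
  have hrange : (EdgeGroup.map hKY.isDiagram.isSimplicial o).range = H := by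
    ext x
    constructor
    · rintro ⟨g, rfl⟩
      obtain ⟨w, rfl⟩ := hsurj g
      rw [hmap]
      exact (φ w).2
    · intro hx
      obtain ⟨w, hw⟩ := hφ ⟨x, hx⟩
      exact ⟨_, (hmap w).trans (congrArg Subtype.val hw)⟩
  exact (MonoidHom.ofInjective hinj).trans (MulEquiv.subgroupCongr hrange)

end PreAbstractSimplicialComplex

/-! ### Edge paths and paths in the geometric realization -/

namespace PreAbstractSimplicialComplex

variable {V : Type*} [Fintype V]

/-- The geometric simplex spanned by `σ`. -/
def geomSimplex (σ : Finset V) : Set (V → ℝ) :=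
  {f | f ∈ stdSimplex ℝ V ∧ ∀ v, f v ≠ 0 → v ∈ σ}

theorem convex_geomSimplex (σ : Finset V) : Convex ℝ (geomSimplex σ) := by
  intro f hf g hg s t hs ht hst
  refine ⟨convex_stdSimplex ℝ V hf.1 hg.1 hs ht hst, fun v hv => ?_⟩
  by_contra h
  have h1 : f v = 0 := by_contra fun h' => h (hf.2 v h')
  have h2 : g v = 0 := by_contra fun h' => h (hg.2 v h')
  exact hv (by simp [h1, h2])

theorem geomSimplex_subset {X : PreAbstractSimplicialComplex V} {σ : Finset V} (hσ : σ ∈ X) :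
    geomSimplex σ ⊆ X.Realization := fun _ hf => ⟨hf.1, σ, hσ, hf.2⟩

theorem pos_of_mem_stdSimplex {f : V → ℝ} (hf : f ∈ stdSimplex ℝ V) {a : V} (ha : f a ≠ 0) :
    0 < f a := lt_of_le_of_ne (hf.1 a) ha.symm

/-- Two points of the realization which lie in a common simplex. -/
def SameSimplex (X : PreAbstractSimplicialComplex V) (p q : X.Realization) : Prop :=
  ∃ σ ∈ X, (p : V → ℝ) ∈ geomSimplex σ ∧ (q : V → ℝ) ∈ geomSimplex σ

/-- The straight path between two points of a simplex. -/
noncomputable def segment (X : PreAbstractSimplicialComplex V) (p q : X.Realization)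
    (h : X.SameSimplex p q) : Path p q where
  toFun t := ⟨(1 - (t : ℝ)) • (p : V → ℝ) + (t : ℝ) • (q : V → ℝ), by
    obtain ⟨σ, hσ, hp, hq⟩ := h
    exact geomSimplex_subset hσ
      (convex_geomSimplex σ hp hq (sub_nonneg.2 t.2.2) t.2.1 (by ring))⟩
  continuous_toFun := by fun_prop
  source' := by ext; simp
  target' := by ext; simp

theorem segment_apply (X : PreAbstractSimplicialComplex V) (p q : X.Realization)
    (h : X.SameSimplex p q) (t : unitInterval) : (X.segment p q h t : V → ℝ) =
      (1 - (t : ℝ)) • (p : V → ℝ) + (t : ℝ) • (q : V → ℝ) := rfl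

theorem segment_mem_convex (X : PreAbstractSimplicialComplex V) (p q : X.Realization)
    (h : X.SameSimplex p q) {S : Set (V → ℝ)} (hS : Convex ℝ S) (hp : (p : V → ℝ) ∈ S)
    (hq : (q : V → ℝ) ∈ S) (t : unitInterval) : (X.segment p q h t : V → ℝ) ∈ S :=
  hS hp hq (sub_nonneg.2 t.2.2) t.2.1 (by ring)

theorem segment_mem_of_starConvex (X : PreAbstractSimplicialComplex V) (p q : X.Realization)
    (h : X.SameSimplex p q) {S : Set (V → ℝ)} (hS : StarConvex ℝ (q : V → ℝ) S)
    (hp : (p : V → ℝ) ∈ S) (t : unitInterval) : (X.segment p q h t : V → ℝ) ∈ S := by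
  rw [segment_apply, add_comm]
  exact hS hp t.2.1 (sub_nonneg.2 t.2.2) (by ring)

/-- Paths with the same ends which run in a star convex set are homotopic. -/
theorem homotopic_of_starConvex {E : Type*} [AddCommGroup E] [Module ℝ E] [TopologicalSpace E]
    [ContinuousAdd E] [ContinuousSMul ℝ E] {B S : Set E} (hSB : S ⊆ B) {x : E}
    (hS : StarConvex ℝ x S) {p q : B} (γ γ' : Path p q) (h : ∀ t, (γ t : E) ∈ S)
    (h' : ∀ t, (γ' t : E) ∈ S) : Path.Homotopic.Quotient.mk γ = Path.Homotopic.Quotient.mk γ' := by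
  have hp : (p : E) ∈ S := by simpa using h 0
  have hq : (q : E) ∈ S := by simpa using h 1
  have : ContractibleSpace S := hS.contractibleSpace ⟨_, hp⟩
  let ι : C(S, B) := ⟨Set.inclusion hSB, continuous_inclusion hSB⟩
  let Γ : Path (⟨p, hp⟩ : S) ⟨q, hq⟩ :=
    { toFun := fun t => ⟨γ t, h t⟩
      continuous_toFun := by fun_prop
      source' := by ext; simp
      target' := by ext; simp }
  let Γ' : Path (⟨p, hp⟩ : S) ⟨q, hq⟩ :=
    { toFun := fun t => ⟨γ' t, h' t⟩
      continuous_toFun := by fun_prop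
      source' := by ext; simp
      target' := by ext; simp }
  have := (SimplyConnectedSpace.paths_homotopic Γ Γ').map ι
  exact Path.Homotopic.Quotient.eq.2 this

/-- The homotopy class of the straight path between two points of a simplex. -/
noncomputable def edge (X : PreAbstractSimplicialComplex V) (p q : X.Realization)
    (h : X.SameSimplex p q) : Path.Homotopic.Quotient p q := Path.Homotopic.Quotient.mk (X.segment p q h)

theorem forall_trans_mem {B : Type*} [TopologicalSpace B] {S : Set B} {p q r : B} {γ : Path p q}
    {γ' : Path q r} (h : ∀ t, γ t ∈ S) (h' : ∀ t, γ' t ∈ S) (t : unitInterval) :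
    γ.trans γ' t ∈ S := by
  rw [Path.trans_apply]
  split_ifs
  · exact h _
  · exact h' _

variable {X : PreAbstractSimplicialComplex V}

theorem edge_trans_edge {p q r : X.Realization} {σ : Finset V} (hσ : σ ∈ X)
    (hp : (p : V → ℝ) ∈ geomSimplex σ) (hq : (q : V → ℝ) ∈ geomSimplex σ)
    (hr : (r : V → ℝ) ∈ geomSimplex σ) :
    (X.edge p q ⟨σ, hσ, hp, hq⟩).trans (X.edge q r ⟨σ, hσ, hq, hr⟩) =
      X.edge p r ⟨σ, hσ, hp, hr⟩ := by
  have hc := convex_geomSimplex σ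
  refine homotopic_of_starConvex (geomSimplex_subset hσ) (hc.starConvex hp)
    ((X.segment p q _).trans (X.segment q r _)) (X.segment p r _) ?_ ?_
  · exact forall_trans_mem (S := Subtype.val ⁻¹' geomSimplex σ)
      (X.segment_mem_convex p q _ hc hp hq) (X.segment_mem_convex q r _ hc hq hr)
  · exact X.segment_mem_convex p r _ hc hp hr

theorem edge_self {p : X.Realization} (h : X.SameSimplex p p) : X.edge p p h = .refl p := by
  obtain ⟨σ, hσ, hp, -⟩ := h
  have hc := convex_geomSimplex σ
  exact homotopic_of_starConvex (geomSimplex_subset hσ) (hc.starConvex hp) _ (.refl p)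
    (X.segment_mem_convex p p _ hc hp hp) fun _ => hp

/-- The open star of a vertex. -/
def openStar (X : PreAbstractSimplicialComplex V) (a : V) : Set (V → ℝ) :=
  {f | f ∈ X.Realization ∧ f a ≠ 0}

variable [DecidableEq V]

theorem single_mem_geomSimplex {a : V} {σ : Finset V} (ha : a ∈ σ) :
    Pi.single a 1 ∈ geomSimplex σ := by
  refine ⟨single_mem_stdSimplex ℝ a, fun v hv => ?_⟩
  obtain rfl : v = a := by_contra fun h => hv (by simp [h])
  exact ha

/-- A vertex as a point of the realization. -/
noncomputable def vert (X : PreAbstractSimplicialComplex V) (a : V) (ha : {a} ∈ X) :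
    X.Realization :=
  ⟨Pi.single a 1, geomSimplex_subset ha (single_mem_geomSimplex (by simp))⟩

theorem vert_mem {a : V} {ha : {a} ∈ X} {σ : Finset V} (h : a ∈ σ) :
    (X.vert a ha : V → ℝ) ∈ geomSimplex σ := single_mem_geomSimplex h

/-- Open stars need not be convex, but each point of one lies in a simplex containing `a`. Star
convexity about `a` is enough to make any two paths with the same ends homotopic. -/
theorem starConvex_openStar (a : V) : StarConvex ℝ (Pi.single a 1) (X.openStar a) := by
  rintro f ⟨⟨h1, σ, hσ, h2⟩, h3⟩ s t hs ht hst
  have ha : a ∈ σ := h2 a h3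
  have hmem := convex_geomSimplex σ (single_mem_geomSimplex ha) ⟨h1, h2⟩ hs ht hst
  refine ⟨geomSimplex_subset hσ hmem, ne_of_gt ?_⟩
  have hfa : 0 < f a := pos_of_mem_stdSimplex h1 h3
  simp only [Pi.add_apply, Pi.smul_apply, Pi.single_eq_same, smul_eq_mul, mul_one]
  rcases hs.eq_or_lt with rfl | hs
  · obtain rfl : t = 1 := by linarith
    simpa using hfa
  · positivity

theorem singleton_mem_of_ne_zero {p : X.Realization} {a : V} (h : (p : V → ℝ) a ≠ 0) :
    {a} ∈ X := by
  obtain ⟨f, h1, σ, hσ, h2⟩ := p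
  exact X.singleton_mem hσ (h2 a h)

theorem sameSimplex_vert {p : X.Realization} {a : V} (h : (p : V → ℝ) a ≠ 0) (ha : {a} ∈ X) :
    X.SameSimplex p (X.vert a ha) := by
  obtain ⟨f, h1, σ, hσ, h2⟩ := p
  exact ⟨σ, hσ, ⟨h1, h2⟩, vert_mem (h2 a h)⟩

theorem SameSimplex.symm {p q : X.Realization} (h : X.SameSimplex p q) : X.SameSimplex q p := by
  obtain ⟨σ, hσ, hp, hq⟩ := h
  exact ⟨σ, hσ, hq, hp⟩

theorem sameSimplex_vert_vert {a b : V} (h : {a, b} ∈ X) (ha : {a} ∈ X) (hb : {b} ∈ X) :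
    X.SameSimplex (X.vert a ha) (X.vert b hb) :=
  ⟨_, h, vert_mem (by simp), vert_mem (by simp)⟩

theorem mk_trans_edge_vert {p q : X.Realization} (γ : Path p q) {a : V}
    (h : ∀ t, (γ t : V → ℝ) a ≠ 0) (ha : {a} ∈ X) (hp : X.SameSimplex p (X.vert a ha))
    (hq : X.SameSimplex q (X.vert a ha)) :
    (Path.Homotopic.Quotient.mk γ).trans (X.edge q (X.vert a ha) hq) = X.edge p (X.vert a ha) hp := by
  have hs := starConvex_openStar (X := X) a
  have hp' : (p : V → ℝ) ∈ X.openStar a := ⟨p.2, by simpa using h 0⟩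
  have hq' : (q : V → ℝ) ∈ X.openStar a := ⟨q.2, by simpa using h 1⟩
  refine homotopic_of_starConvex (fun f hf => hf.1) hs (γ.trans (X.segment q _ hq))
    (X.segment p _ hp) ?_ ?_
  · exact forall_trans_mem (S := Subtype.val ⁻¹' X.openStar a)
      (fun t => ⟨(γ t).2, h t⟩) (X.segment_mem_of_starConvex q _ hq hs hq')
  · exact X.segment_mem_of_starConvex p _ hp hs hp'

/-- The homotopy class of paths in the realization given by an edge path. -/
noncomputable def pathClass (X : PreAbstractSimplicialComplex V) : (l : List V) → (a b : V) →
    (ha : {a} ∈ X) → (hb : {b} ∈ X) → X.IsPath a l b → Path.Homotopic.Quotient (X.vert a ha) (X.vert b hb)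
  | [], a, b, ha, hb, h => (Path.Homotopic.Quotient.refl (X.vert a ha)).cast rfl
      (by obtain rfl : a = b := h; rfl)
  | c :: l, a, b, ha, hb, h =>
    (X.edge (X.vert a ha) (X.vert c (X.singleton_mem h.1 (by simp)))
      (sameSimplex_vert_vert h.1 _ _)).trans
      (pathClass X l c b (X.singleton_mem h.1 (by simp)) hb h.2)

theorem isPath_nil (a : V) : X.IsPath a [] a := rfl

theorem isPath_singleton {a b : V} (h : {a, b} ∈ X) : X.IsPath a [b] b := ⟨h, rfl⟩

theorem pathClass_nil {a : V} (ha : {a} ∈ X) (h : X.IsPath a [] a) :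
    X.pathClass [] a a ha ha h = .refl _ := by
  simp [pathClass]

theorem pathClass_cons {a b c : V} {l : List V} (ha : {a} ∈ X) (hb : {b} ∈ X) (hc : {c} ∈ X)
    (h : X.IsPath a (c :: l) b) : X.pathClass (c :: l) a b ha hb h =
      (X.edge (X.vert a ha) (X.vert c hc) (sameSimplex_vert_vert h.1 _ _)).trans
        (X.pathClass l c b hc hb h.2) := rfl

theorem pathClass_singleton {a b : V} (ha : {a} ∈ X) (hb : {b} ∈ X) (h : X.IsPath a [b] b) :
    X.pathClass [b] a b ha hb h = X.edge _ _ (sameSimplex_vert_vert h.1 ha hb) := by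
  rw [pathClass_cons ha hb hb, pathClass_nil hb h.2, Path.Homotopic.Quotient.trans_refl]

theorem pathClass_append {a b c : V} {l m : List V} (ha : {a} ∈ X) (hb : {b} ∈ X)
    (hc : {c} ∈ X) (hl : X.IsPath a l b) (hm : X.IsPath b m c) :
    X.pathClass (l ++ m) a c ha hc (hl.append hm) =
      (X.pathClass l a b ha hb hl).trans (X.pathClass m b c hb hc hm) := by
  induction l generalizing a with
  | nil =>
    obtain rfl : a = b := hl
    exact ((congrArg (fun x => Path.Homotopic.Quotient.trans x (X.pathClass m a c ha hc hm))
      (pathClass_nil ha (isPath_nil a))).trans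
      (Path.Homotopic.Quotient.refl_trans _)).symm
  | cons d l ih =>
    have hd : {d} ∈ X := X.singleton_mem hl.1 (by simp)
    rw [pathClass_cons ha hb hd, Path.Homotopic.Quotient.trans_assoc, ← ih hd hl.2]
    exact pathClass_cons ha hc hd _

theorem Step.pathClass_eq {a b : V} {l l' : List V} (h : X.Step a l l') (ha : {a} ∈ X)
    (hb : {b} ∈ X) (hl : X.IsPath a l b) (hl' : X.IsPath a l' b) :
    X.pathClass l a b ha hb hl = X.pathClass l' a b ha hb hl' := by
  induction h with
  | stay h =>
    rw [pathClass_cons ha hb ha, edge_self, Path.Homotopic.Quotient.refl_trans]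
  | @tri a c d l h =>
    have hc : {c} ∈ X := X.singleton_mem h (by simp)
    have hd : {d} ∈ X := X.singleton_mem h (by simp)
    rw [pathClass_cons ha hb hc, pathClass_cons hc hb hd, pathClass_cons ha hb hd,
      ← Path.Homotopic.Quotient.trans_assoc]
    congr 1
    exact edge_trans_edge h (vert_mem (by simp)) (vert_mem (by simp)) (vert_mem (by simp))
  | @cons a c l l' h ih =>
    have hc : {c} ∈ X := X.singleton_mem hl.1 (by simp)
    rw [pathClass_cons ha hb hc, pathClass_cons ha hb hc, ih hc hl.2 hl'.2]

theorem Htpy.pathClass_eq {a b : V} {l l' : List V} (h : X.Htpy a l l') (ha : {a} ∈ X)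
    (hb : {b} ∈ X) (hl : X.IsPath a l b) (hl' : X.IsPath a l' b) :
    X.pathClass l a b ha hb hl = X.pathClass l' a b ha hb hl' := by
  induction h with
  | rel _ _ h => exact h.pathClass_eq ha hb hl hl'
  | refl _ => rfl
  | symm _ _ _ ih => exact (ih hl' hl).symm
  | trans _ _ _ h _ ih ih' =>
    have := (Htpy.isPath_iff h).1 hl
    exact (ih hl this).trans (ih' this hl')

theorem exists_ne_zero (p : X.Realization) : ∃ a, (p : V → ℝ) a ≠ 0 := by
  by_contra! h
  have := p.2.1.2
  simp [h] at this

theorem exists_simplex_of_ne_zero {p : X.Realization} {a b : V} (ha : (p : V → ℝ) a ≠ 0)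
    (hb : (p : V → ℝ) b ≠ 0) :
    ∃ σ ∈ X, (p : V → ℝ) ∈ geomSimplex σ ∧ a ∈ σ ∧ b ∈ σ := by
  obtain ⟨f, h1, σ, hσ, h2⟩ := p
  exact ⟨σ, hσ, ⟨h1, h2⟩, h2 a ha, h2 b hb⟩

/-- Every path in the realization of a complex is homotopic to an edge path, up to segments which
join its ends to vertices. -/
theorem exists_pathClass_eq {p q : X.Realization} (γ : Path p q) {a b : V}
    (hpa : (p : V → ℝ) a ≠ 0) (hqb : (q : V → ℝ) b ≠ 0) (ha : {a} ∈ X) (hb : {b} ∈ X) :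
    ∃ l, ∃ hl : X.IsPath a l b, X.pathClass l a b ha hb hl =
      ((X.edge _ _ (sameSimplex_vert hpa ha).symm).trans (Path.Homotopic.Quotient.mk γ)).trans
        (X.edge _ _ (sameSimplex_vert hqb hb)) := by
  -- The open stars cover the realization, so a fine enough subdivision of `γ` puts each piece into
  -- one of them; each piece is then replaced by a detour through the corresponding vertex.
  obtain ⟨t, ht0, htm, ⟨N, hN⟩, htc⟩ := exists_monotone_Icc_subset_open_cover_unitInterval
    (c := fun v : V => {s | (γ s : V → ℝ) v ≠ 0})
    (fun v => isOpen_ne_fun ((continuous_apply v).comp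
      (continuous_subtype_val.comp γ.continuous)) continuous_const) (fun s _ => by
      obtain ⟨v, hv⟩ := exists_ne_zero (γ s)
      exact Set.mem_iUnion.2 ⟨v, hv⟩)
  have h0a : (γ 0 : V → ℝ) a ≠ 0 := by simpa using hpa
  have key : ∀ n s, s = t n → ∀ v (hv : {v} ∈ X) (h : (γ s : V → ℝ) v ≠ 0),
      ∃ l, ∃ hl : X.IsPath a l v, X.pathClass l a v ha hv hl =
        ((X.edge _ _ (sameSimplex_vert h0a ha).symm).trans (Path.Homotopic.Quotient.mk (γ.subpath 0 s))).trans
          (X.edge _ _ (sameSimplex_vert h hv)) := by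
    intro n
    induction n with
    | zero =>
      intro s hs v hv h
      obtain rfl : s = 0 := hs.trans ht0
      obtain ⟨σ, hσ, h1, h2, h3⟩ := exists_simplex_of_ne_zero h0a h
      have hav := X.pair_mem hσ h2 h3
      refine ⟨[v], isPath_singleton hav, ?_⟩
      rw [pathClass_singleton ha hv, Path.subpath_self,
        Path.Homotopic.Quotient.mk_refl, Path.Homotopic.Quotient.trans_refl]
      exact (edge_trans_edge hσ (vert_mem h2) h1 (vert_mem h3)).symm
    | succ n ih =>
      intro s hs v hv h
      obtain ⟨w, hw⟩ := htc n
      have hle : t n ≤ s := hs ▸ htm (Nat.le_succ n)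
      have hnw : (γ (t n) : V → ℝ) w ≠ 0 := hw ⟨le_rfl, htm (Nat.le_succ n)⟩
      have hsw : (γ s : V → ℝ) w ≠ 0 := hw ⟨hle, hs.le⟩
      have hwX := singleton_mem_of_ne_zero hnw
      obtain ⟨l, hl, e⟩ := ih (t n) rfl w hwX hnw
      obtain ⟨σ, hσ, h1, h2, h3⟩ := exists_simplex_of_ne_zero hsw h
      have hwv := X.pair_mem hσ h2 h3
      refine ⟨l ++ [v], hl.append (isPath_singleton hwv), ?_⟩
      have hsub : ∀ u, ((γ.subpath (t n) s) u : V → ℝ) w ≠ 0 := by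
        intro u
        obtain ⟨u', hu', e⟩ : γ.subpath (t n) s u ∈ γ '' Set.Icc (t n) s := by
          rw [← Path.range_subpath_of_le γ _ _ hle]
          exact ⟨u, rfl⟩
        rw [← e]
        exact hw ⟨hu'.1, hu'.2.trans hs.le⟩
      have e1 := mk_trans_edge_vert (γ.subpath (t n) s) hsub hwX (sameSimplex_vert hnw hwX)
        (sameSimplex_vert hsw hwX)
      have e2 : Path.Homotopic.Quotient.mk (γ.subpath 0 s) =
          (Path.Homotopic.Quotient.mk (γ.subpath 0 (t n))).trans (Path.Homotopic.Quotient.mk (γ.subpath (t n) s)) :=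
        (Path.Homotopic.Quotient.eq.2 ⟨Path.Homotopy.subpathTransSubpath γ 0 (t n) s⟩).symm
      have e3 := edge_trans_edge hσ h1 (vert_mem (ha := hwX) h2) (vert_mem (ha := hv) h3)
      rw [pathClass_append ha hwX hv hl (isPath_singleton hwv), e, pathClass_singleton hwX hv,
        ← e1, e2, ← e3]
      simp only [Path.Homotopic.Quotient.trans_assoc]
  have h1b : (γ 1 : V → ℝ) b ≠ 0 := by simpa using hqb
  obtain ⟨l, hl, e⟩ := key N 1 (hN N le_rfl).symm b hb h1b
  refine ⟨l, hl, e.trans ?_⟩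
  have : ∀ x y (hx : x = p) (hy : y = q) (h1 : X.SameSimplex (X.vert a ha) x)
      (h2 : X.SameSimplex y (X.vert b hb)) (h1' : X.SameSimplex (X.vert a ha) p)
      (h2' : X.SameSimplex q (X.vert b hb)),
      ((X.edge _ _ h1).trans (Path.Homotopic.Quotient.mk (γ.cast hx hy))).trans (X.edge _ _ h2) =
      ((X.edge _ _ h1').trans (Path.Homotopic.Quotient.mk γ)).trans (X.edge _ _ h2') := by
    rintro x y rfl rfl _ _ _ _
    rfl
  rw [Path.subpath_zero_one]
  exact this _ _ γ.source γ.target _ _ _ _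

end PreAbstractSimplicialComplex

/-! ### The covering defined by a cocycle, and injectivity via monodromy -/

namespace PreAbstractSimplicialComplex

variable {V : Type*} [DecidableEq V] {X : PreAbstractSimplicialComplex V}

/-- The product of the values of `c` along an edge path, the last edge being the leftmost factor. -/
def holonomy {G : Type*} [Group G] (c : V → V → G) : V → List V → G
  | _, [] => 1
  | a, b :: l => holonomy c b l * c a b

/-- The edge path group carries a cocycle whose holonomy along a loop is conjugate to its class. -/
theorem exists_edgeGroup_cocycle (X : PreAbstractSimplicialComplex V) (v : V) :
    ∃ c : V → V → X.EdgeGroup v, (∀ a b d, {a, b, d} ∈ X → c b d * c a b = c a d) ∧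
      ∀ l (hl : X.IsPath v l v), holonomy c v l = 1 → EdgeGroup.mk l hl = 1 := by
  classical
  have hτ : ∀ a, ∃ τ : List V × List V, (∃ l, X.IsPath v l a) → X.IsPath v τ.1 a ∧
      X.IsPath a τ.2 v ∧ X.Htpy v (τ.1 ++ τ.2) [] ∧ X.Htpy a (τ.2 ++ τ.1) [] := by
    intro a
    by_cases h : ∃ l, X.IsPath v l a
    · obtain ⟨l, hl⟩ := h
      obtain ⟨l', h⟩ := hl.exists_inv
      exact ⟨(l, l'), fun _ => ⟨hl, h⟩⟩
    · exact ⟨([], []), fun h' => absurd h' h⟩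
  choose τ hτ using hτ
  have hloop : ∀ a b, (∃ l, X.IsPath v l a) ∧ {a, b} ∈ X →
      X.IsPath v ((τ a).1 ++ b :: (τ b).2) v := by
    rintro a b ⟨⟨l, hl⟩, hab⟩
    exact (hτ a ⟨l, hl⟩).1.append ⟨hab, (hτ b ⟨l ++ [b], hl.append ⟨hab, rfl⟩⟩).2.1⟩
  -- The cocycle sends an edge `ab` to the loop which goes to `a` along a chosen path, crosses the
  -- edge and returns from `b`. Outside the component of `v` it takes the value `1`.
  let c : V → V → X.EdgeGroup v := fun a b =>
    if h : (∃ l, X.IsPath v l a) ∧ {a, b} ∈ X then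
      EdgeGroup.mk ((τ a).1 ++ b :: (τ b).2) (hloop a b h) else 1
  refine ⟨c, fun a b d habd => ?_, fun l hl h => ?_⟩
  · have hab : {a, b} ∈ X := X.pair_mem habd (by simp) (by simp)
    have hbd : {b, d} ∈ X := X.pair_mem habd (by simp) (by simp)
    have had : {a, d} ∈ X := X.pair_mem habd (by simp) (by simp)
    by_cases ha : ∃ l, X.IsPath v l a
    · have hb : ∃ l, X.IsPath v l b := ha.imp' (· ++ [b]) fun l hl => hl.append ⟨hab, rfl⟩
      simp only [c, dif_pos (show _ ∧ _ from ⟨ha, hab⟩), dif_pos (show _ ∧ _ from ⟨ha, had⟩),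
        dif_pos (show _ ∧ _ from ⟨hb, hbd⟩), EdgeGroup.mk_mul_mk]
      refine EdgeGroup.mk_eq_mk.2 ?_
      have h1 : X.Htpy a (b :: (((τ b).2 ++ (τ b).1) ++ d :: (τ d).2)) (b :: ([] ++ d :: (τ d).2)) :=
        ((hτ b hb).2.2.2.append_right _).cons
      simpa using (h1.trans (.tri habd)).append_left (hτ a ha).1
    · have hb : ¬ ∃ l, X.IsPath v l b := fun ⟨l, hl⟩ =>
        ha ⟨l ++ [a], hl.append ⟨pair_comm hab, rfl⟩⟩
      simp [c, ha, hb]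
  · have key : ∀ l a (ha : ∃ l, X.IsPath v l a) (hl : X.IsPath a l v),
        holonomy c a l = EdgeGroup.mk ((τ a).1 ++ l ++ (τ v).2)
          (((hτ a ha).1.append hl).append (hτ v ⟨[], rfl⟩).2.1) := by
      intro l
      induction l with
      | nil =>
        intro a ha hl
        obtain rfl : a = v := hl
        exact (EdgeGroup.mk_eq_one.2 (by simpa using (hτ a ha).2.2.1)).symm
      | cons b l ih =>
        intro a ha hl
        have hb : ∃ l, X.IsPath v l b := ha.imp' (· ++ [b]) fun m hm => hm.append ⟨hl.1, rfl⟩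
        have hc : c a b = EdgeGroup.mk ((τ a).1 ++ b :: (τ b).2) (hloop a b ⟨ha, hl.1⟩) :=
          dif_pos ⟨ha, hl.1⟩
        rw [holonomy, ih b hb hl.2, hc, EdgeGroup.mk_mul_mk]
        refine EdgeGroup.mk_eq_mk.2 ?_
        have h1 : X.Htpy a (b :: (((τ b).2 ++ (τ b).1) ++ (l ++ (τ v).2)))
            (b :: ([] ++ (l ++ (τ v).2))) := ((hτ b hb).2.2.2.append_right _).cons
        simpa using h1.append_left (hτ a ha).1
    have hv : ∃ l, X.IsPath v l v := ⟨[], rfl⟩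
    rw [key l v hv hl] at h
    have h1 := EdgeGroup.mk_eq_one.1 h
    obtain ⟨h2, h3, h4, h5⟩ := hτ v hv
    -- The chosen path from `v` to itself need not be constant, so the holonomy is only conjugate to
    -- the class of `l`; the conjugation is undone here.
    refine EdgeGroup.mk_eq_one.2 ?_
    have e1 : X.Htpy v (((τ v).2 ++ (τ v).1) ++ (l ++ ((τ v).2 ++ (τ v).1))) ([] ++ (l ++ [])) :=
      Htpy.append (h3.append h2) h5 (Htpy.append_left hl h5)
    have e2 : X.Htpy v ((τ v).2 ++ (((τ v).1 ++ l ++ (τ v).2) ++ (τ v).1)) ((τ v).2 ++ ([] ++ (τ v).1)) :=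
      Htpy.append_left h3 (h1.append_right _)
    simp only [List.append_assoc, List.nil_append, List.append_nil] at e1 e2
    exact e1.symm.trans (e2.trans h5)

variable [Fintype V]

/-- The covering of the realization defined by a cocycle. -/
noncomputable def coverCore {G : Type*} [Group G] [TopologicalSpace G] [DiscreteTopology G]
    (c : V → V → G) (hc : ∀ a b d, {a, b, d} ∈ X → c b d * c a b = c a d) :
    FiberBundleCore V X.Realization G where
  baseSet a := {p | (p : V → ℝ) a ≠ 0}
  isOpen_baseSet a := isOpen_ne_fun ((continuous_apply a).comp continuous_subtype_val)
    continuous_const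
  indexAt p := (exists_ne_zero p).choose
  mem_baseSet_at p := (exists_ne_zero p).choose_spec
  coordChange a b _ s := c a b * s
  coordChange_self a p hp s := by
    have : ({a, a, a} : Finset V) ∈ X := by simpa using singleton_mem_of_ne_zero hp
    rw [show c a a = 1 by simpa using hc a a a this, one_mul]
  continuousOn_coordChange a b :=
    (continuous_of_discreteTopology.comp continuous_snd :
      Continuous fun p : X.Realization × G => c a b * p.2).continuousOn
  coordChange_comp a b d p hp s := by
    obtain ⟨f, h1, σ, hσ, h2⟩ := p
    have ha := h2 a hp.1.1
    have hb := h2 b hp.1.2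
    have hd := h2 d hp.2
    rw [← mul_assoc, hc a b d (X.mem_of_subset hσ (by simp [Finset.insert_subset_iff, *])
      (by simp))]

section

variable {G : Type*} [Group G] [TopologicalSpace G] [DiscreteTopology G]
  (c : V → V → G) (hc : ∀ a b d, {a, b, d} ∈ X → c b d * c a b = c a d)

/-- The point over `p` with coordinate `s` in the chart over the open star of `a`. -/
noncomputable def coverPoint (a : V) (p : X.Realization) (s : G) : (coverCore c hc).TotalSpace :=
  ⟨p, (coverCore c hc).coordChange a ((coverCore c hc).indexAt p) p s⟩

theorem coverPoint_injective (a : V) (p : X.Realization) :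
    Function.Injective (coverPoint c hc a p) := by
  intro s t h
  have : c a ((coverCore c hc).indexAt p) * s = c a ((coverCore c hc).indexAt p) * t :=
    eq_of_heq (Bundle.TotalSpace.mk.inj h).2
  exact mul_left_cancel this

theorem coverPoint_change {a b : V} {p : X.Realization} (ha : (p : V → ℝ) a ≠ 0)
    (hb : (p : V → ℝ) b ≠ 0) (s : G) :
    coverPoint c hc b p (c a b * s) = coverPoint c hc a p s := by
  have := (coverCore c hc).coordChange_comp a b ((coverCore c hc).indexAt p) p
    ⟨⟨ha, hb⟩, (coverCore c hc).mem_baseSet_at p⟩ s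
  exact congrArg (Bundle.TotalSpace.mk p) this

theorem coverPoint_path_continuous {p q : X.Realization} (γ : Path p q) {a : V}
    (h : ∀ t, (γ t : V → ℝ) a ≠ 0) (s : G) :
    Continuous fun t => coverPoint c hc a (γ t) s :=
  ((coverCore c hc).localTriv a).toOpenPartialHomeomorph.continuousOn_symm.comp_continuous
    (f := fun t => (γ t, s)) (by fun_prop) fun t => by
      rw [FiberBundleCore.mem_localTriv_target]
      exact h t

theorem isCoveringMap_coverCore : IsCoveringMap (coverCore c hc).proj :=
  FiberBundle.isCoveringMap (F := G) (E := (coverCore c hc).Fiber)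

/-- In the chart over the open star of `a`, the lift is the path with constant coordinate `s`. -/
theorem monodromy_of_openStar {p q : X.Realization} (γ : Path p q) {a : V}
    (h : ∀ t, (γ t : V → ℝ) a ≠ 0) (s : G) :
    (isCoveringMap_coverCore c hc).monodromy (Path.Homotopic.Quotient.mk γ)
      ⟨coverPoint c hc a p s, rfl⟩ = ⟨coverPoint c hc a q s, rfl⟩ := by
  let Γ : Path (coverPoint c hc a p s) (coverPoint c hc a q s) :=
    { toFun := fun t => coverPoint c hc a (γ t) s
      continuous_toFun := coverPoint_path_continuous c hc γ h s
      source' := by simp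
      target' := by simp }
  refine (isCoveringMap_coverCore c hc).monodromy_eq_of_map_eq (Path.Homotopic.Quotient.mk Γ) ?_
  exact congrArg Path.Homotopic.Quotient.mk (by ext1; rfl)

theorem convex_setOf_pos (a : V) : Convex ℝ {f : V → ℝ | 0 < f a} := by
  intro f hf g hg s t hs ht hst
  simp only [Set.mem_ofPred_eq, Pi.add_apply, Pi.smul_apply, smul_eq_mul] at *
  rcases hs.eq_or_lt with rfl | hs
  · obtain rfl : t = 1 := by linarith
    simpa using hg
  · positivity

theorem monodromy_edge_of_ne_zero {p q : X.Realization} (h : X.SameSimplex p q) {a : V}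
    (hp : (p : V → ℝ) a ≠ 0) (hq : (q : V → ℝ) a ≠ 0) (s : G) :
    (isCoveringMap_coverCore c hc).monodromy (X.edge p q h)
      ⟨coverPoint c hc a p s, rfl⟩ = ⟨coverPoint c hc a q s, rfl⟩ :=
  monodromy_of_openStar c hc _ (fun t => ne_of_gt (X.segment_mem_convex p q h (convex_setOf_pos a)
    (pos_of_mem_stdSimplex p.2.1 hp) (pos_of_mem_stdSimplex q.2.1 hq) t)) s

theorem monodromy_edge {a b : V} (ha : {a} ∈ X) (hb : {b} ∈ X) (hab : {a, b} ∈ X) (s : G) :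
    (isCoveringMap_coverCore c hc).monodromy
      (X.edge (X.vert a ha) (X.vert b hb) (sameSimplex_vert_vert hab ha hb))
      ⟨coverPoint c hc a (X.vert a ha) s, rfl⟩ =
      ⟨coverPoint c hc b (X.vert b hb) (c a b * s), rfl⟩ := by
  -- The midpoint lies in both open stars. The chart of `a` serves up to `m`, the chart of `b` from
  -- there on, and the change of chart contributes the factor `c a b`.
  let m : X.Realization := X.segment _ _ (sameSimplex_vert_vert hab ha hb) ⟨1 / 2, by norm_num⟩
  have hm : (m : V → ℝ) = (1 - 1 / 2 : ℝ) • Pi.single a 1 + (1 / 2 : ℝ) • Pi.single b 1 :=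
    X.segment_apply _ _ _ _
  have hmσ : (m : V → ℝ) ∈ geomSimplex {a, b} :=
    X.segment_mem_convex _ _ _ (convex_geomSimplex _) (vert_mem (by simp)) (vert_mem (by simp)) _
  have hma : (m : V → ℝ) a ≠ 0 := by
    rw [hm]
    by_cases h : a = b
    · subst h
      norm_num
    · simp [h]
      norm_num
  have hmb : (m : V → ℝ) b ≠ 0 := by
    rw [hm]
    by_cases h : a = b
    · subst h
      norm_num
    · simp [Ne.symm h]
  have haσ : (X.vert a ha : V → ℝ) ∈ geomSimplex {a, b} := vert_mem (by simp)
  have hbσ : (X.vert b hb : V → ℝ) ∈ geomSimplex {a, b} := vert_mem (by simp)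
  have h1 : X.SameSimplex (X.vert a ha) m := ⟨_, hab, haσ, hmσ⟩
  have h2 : X.SameSimplex m (X.vert b hb) := ⟨_, hab, hmσ, hbσ⟩
  have h3 : X.edge _ _ (sameSimplex_vert_vert hab ha hb) = (X.edge _ _ h1).trans (X.edge _ _ h2) :=
    (edge_trans_edge hab haσ hmσ hbσ).symm
  rw [h3, IsCoveringMap.monodromy_trans_apply,
    monodromy_edge_of_ne_zero c hc h1 (by simp [vert]) hma s]
  have e : (⟨coverPoint c hc a m s, rfl⟩ : (coverCore c hc).proj ⁻¹' {m}) =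
      ⟨coverPoint c hc b m (c a b * s), rfl⟩ :=
    Subtype.ext (coverPoint_change c hc hma hmb s).symm
  rw [e]
  exact monodromy_edge_of_ne_zero c hc h2 hmb (by simp [vert]) _

theorem monodromy_pathClass {a b : V} {l : List V} (ha : {a} ∈ X) (hb : {b} ∈ X)
    (hl : X.IsPath a l b) (s : G) :
    (isCoveringMap_coverCore c hc).monodromy (X.pathClass l a b ha hb hl)
      ⟨coverPoint c hc a (X.vert a ha) s, rfl⟩ =
      ⟨coverPoint c hc b (X.vert b hb) (holonomy c a l * s), rfl⟩ := by
  induction l generalizing a s with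
  | nil =>
    obtain rfl : a = b := hl
    have h := pathClass_nil ha (isPath_nil a)
    rw [show X.pathClass [] a a ha hb (isPath_nil a) = _ from h, IsCoveringMap.monodromy_refl]
    simp [holonomy]
  | cons d l ih =>
    have hd : {d} ∈ X := X.singleton_mem hl.1 (by simp)
    rw [pathClass_cons ha hb hd, IsCoveringMap.monodromy_trans_apply, monodromy_edge c hc ha hd hl.1,
      ih hd hl.2, holonomy, mul_assoc]

end

/-- An edge loop which is null-homotopic in the realization is trivial in the edge path group. -/
theorem mk_eq_one_of_pathClass_eq_refl {v : V} (hv : {v} ∈ X) {l : List V} (hl : X.IsPath v l v)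
    (h : X.pathClass l v v hv hv hl = .refl _) : EdgeGroup.mk l hl = 1 := by
  obtain ⟨c, hc, hhol⟩ := exists_edgeGroup_cocycle X v
  -- With the discrete topology on the fibre the bundle is a covering, and a null-homotopic loop
  -- acts trivially on it, so its holonomy is `1`.
  let _ : TopologicalSpace (X.EdgeGroup v) := ⊥
  have : DiscreteTopology (X.EdgeGroup v) := ⟨rfl⟩
  have h1 := monodromy_pathClass c hc hv hv hl 1
  rw [h, IsCoveringMap.monodromy_refl] at h1
  have h2 := coverPoint_injective c hc v _ (congrArg Subtype.val h1)
  exact hhol l hl (by simpa using h2.symm)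

/-- The edge path group is the fundamental group of the realization. -/
noncomputable def edgeGroupEquiv (X : PreAbstractSimplicialComplex V) (v : V) (hv : {v} ∈ X) :
    X.EdgeGroup v ≃* FundamentalGroup X.Realization (X.vert v hv) := by
  let Φ : X.EdgeGroup v →* FundamentalGroup X.Realization (X.vert v hv) :=
    { toFun := Quotient.lift (fun l => X.pathClass l.1 v v hv hv l.2)
        fun l m h => Htpy.pathClass_eq h hv hv l.2 m.2
      map_one' := pathClass_nil hv rfl
      map_mul' := by
        rintro ⟨l⟩ ⟨m⟩
        exact pathClass_append hv hv hv m.2 l.2 }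
  refine MulEquiv.ofBijective Φ ⟨(injective_iff_map_eq_one Φ).2 fun g hg => ?_, fun γ => ?_⟩
  · obtain ⟨l, hl, rfl⟩ := g.exists_mk
    exact mk_eq_one_of_pathClass_eq_refl hv hl hg
  · obtain ⟨γ, rfl⟩ := Path.Homotopic.Quotient.mk_surjective γ
    have hne : (X.vert v hv : V → ℝ) v ≠ 0 := by simp [vert]
    obtain ⟨l, hl, e⟩ := exists_pathClass_eq γ hne hne hv hv
    refine ⟨EdgeGroup.mk l hl, e.trans ?_⟩
    rw [edge_self, Path.Homotopic.Quotient.refl_trans,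
      Path.Homotopic.Quotient.trans_refl]

/-- The realization of a nonempty edge connected complex is path connected. -/
theorem pathConnectedSpace_realization {o : V} (ho : {o} ∈ X)
    (h : ∀ p, {p} ∈ X → ∃ l, X.IsPath o l p) : PathConnectedSpace X.Realization := by
  have key : ∀ p, Joined (X.vert o ho) p := by
    intro p
    obtain ⟨a, ha⟩ := exists_ne_zero p
    have haX := singleton_mem_of_ne_zero ha
    obtain ⟨l, hl⟩ := h a haX
    obtain ⟨γ, -⟩ := Path.Homotopic.Quotient.mk_surjective (X.pathClass l o a ho haX hl)
    exact ⟨γ.trans (X.segment _ _ (sameSimplex_vert ha haX).symm)⟩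
  exact ⟨⟨X.vert o ho⟩, fun p q => (key p).symm.trans (key q)⟩

end PreAbstractSimplicialComplex

/-! ### Restriction to a finite vertex type, and conclusion -/

namespace PreAbstractSimplicialComplex

section

variable {M : Type*} [DecidableEq M] (Y : PreAbstractSimplicialComplex M)

/-- The complex `Y`, regarded as a complex on the type of its vertices. -/
def onVertices : PreAbstractSimplicialComplex {p // {p} ∈ Y} :=
  Y.pullback Subtype.val fun _ => True

variable {Y}

theorem isSimplicial_val : IsSimplicial Subtype.val Y.onVertices Y := fun _ hs => hs.1

/-- Elements of `M` which are not vertices of `Y` are sent to `o`; no simplex contains them. The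
resulting simplicial map carries homotopies back to the restricted complex. -/
theorem exists_retraction_onVertices (o : {p // {p} ∈ Y}) :
    ∃ g : M → {p // {p} ∈ Y}, (∀ p, g p.1 = p) ∧ IsSimplicial g Y Y.onVertices := by
  classical
  have hg : ∀ p (h : {p} ∈ Y), (if h : {p} ∈ Y then (⟨p, h⟩ : {p // {p} ∈ Y}) else o) = ⟨p, h⟩ :=
    fun p h => dif_pos h
  refine ⟨fun p => if h : {p} ∈ Y then ⟨p, h⟩ else o, fun p => hg p.1 p.2, fun s hs =>
    ⟨?_, fun _ _ => trivial⟩⟩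
  rw [Finset.image_image]
  convert hs
  conv_rhs => rw [← Finset.image_id (s := s)]
  refine Finset.image_congr fun p hp => ?_
  simp [hg p (Y.singleton_mem hs hp)]

theorem exists_isPath_onVertices {a b : {p // {p} ∈ Y}} {l : List M} (hl : Y.IsPath a l b) :
    ∃ l', Y.onVertices.IsPath a l' b ∧ l'.map Subtype.val = l := by
  induction l generalizing a with
  | nil => exact ⟨[], Subtype.ext hl, rfl⟩
  | cons c l ih =>
    obtain ⟨l', h1, h2⟩ := ih (a := ⟨c, Y.singleton_mem hl.1 (by simp)⟩) hl.2
    refine ⟨⟨c, Y.singleton_mem hl.1 (by simp)⟩ :: l', ⟨⟨?_, fun _ _ => trivial⟩, h1⟩, by simp [h2]⟩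
    simpa [Finset.image_insert] using hl.1

theorem bijective_map_val (o : {p // {p} ∈ Y}) :
    Function.Bijective (EdgeGroup.map (isSimplicial_val (Y := Y)) o) := by
  refine ⟨(injective_iff_map_eq_one _).2 fun u hu => ?_, fun u => ?_⟩
  · obtain ⟨l, hl, rfl⟩ := u.exists_mk
    obtain ⟨g, hg, hgs⟩ := exists_retraction_onVertices o
    have h := (EdgeGroup.mk_eq_one.1 hu).map hgs
    rw [hg, List.map_map, show g ∘ Subtype.val = id from funext hg, List.map_id] at h
    exact EdgeGroup.mk_eq_one.2 h
  · obtain ⟨l, hl, rfl⟩ := u.exists_mk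
    obtain ⟨l', h1, rfl⟩ := exists_isPath_onVertices hl
    exact ⟨EdgeGroup.mk l' h1, rfl⟩

end

/-- Infinite fibres supply a fresh vertex over each vertex of `X` whatever the finite diagram; using
`ℕ` also places the final vertex set in `Type`. -/
theorem exists_infinite_fibers {V : Type*} [Finite V] (v : V) :
    ∃ (f : ℕ → V) (o : ℕ), f o = v ∧ ∀ w, (f ⁻¹' {w}).Infinite := by
  have : Nonempty V := ⟨v⟩
  obtain ⟨e⟩ := nonempty_equiv_of_countable (α := ℕ) (β := ℕ × V)
  refine ⟨fun n => (e n).2, e.symm (0, v), by simp, fun w => ?_⟩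
  refine Set.infinite_of_injective_forall_mem (f := fun n : ℕ => e.symm (n, w)) ?_ (by simp)
  intro m n h
  simpa using h

/-- Every finitely presented subgroup of the fundamental group of a finite complex with `SD₂*(k)`
links is the fundamental group of a finite connected complex with `SD₂*(k)` links. -/
theorem HasSD2StarLinks.exists_fundamentalGroup_mulEquiv {V : Type*} [Fintype V] [DecidableEq V]
    {k : ℕ} {X : PreAbstractSimplicialComplex V} (hX : X.HasSD2StarLinks k)
    (x : X.Realization) (H : Subgroup (FundamentalGroup X.Realization x))
    (hH : Group.IsFinitelyPresented H) :
    ∃ (W : Type) (_ : Fintype W) (_ : DecidableEq W) (Y : PreAbstractSimplicialComplex W),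
      Y.HasSD2StarLinks k ∧ PathConnectedSpace Y.Realization ∧
        ∀ y : Y.Realization, Nonempty (H ≃* FundamentalGroup Y.Realization y) := by
  -- The base point need not be a vertex; a straight segment moves it to a vertex of a simplex
  -- containing it.
  obtain ⟨v, hxv⟩ := exists_ne_zero x
  have hv := singleton_mem_of_ne_zero hxv
  obtain ⟨f, o, rfl, hf⟩ := exists_infinite_fibers v
  let e : FundamentalGroup X.Realization x ≃* X.EdgeGroup (f o) :=
    (FundamentalGroup.fundamentalGroupMulEquivOfPath
      (X.segment _ _ (sameSimplex_vert hxv hv))).trans (X.edgeGroupEquiv (f o) hv).symm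
  let eH : H ≃* H.map e.toMonoidHom := H.equivMapOfInjective _ e.injective
  obtain ⟨Y, hY, hYd, ⟨eY⟩⟩ := hX.hasConedPendants.exists_mulEquiv_edgeGroup hf hv
    (H.map e.toMonoidHom) (Group.IsFinitelyPresented.equiv eH)
  let o' : {p // {p} ∈ Y} := ⟨o, hYd.base_mem⟩
  have ho' : {o'} ∈ Y.onVertices := ⟨by simpa using hYd.base_mem, fun _ _ => trivial⟩
  let _ : Fintype {p // {p} ∈ Y} := hYd.finite.fintype
  have hconn : PathConnectedSpace Y.onVertices.Realization :=
    pathConnectedSpace_realization ho' fun p hp => by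
      obtain ⟨l, hl⟩ := hYd.connected p p.2
      obtain ⟨l', hl', -⟩ := exists_isPath_onVertices (a := o') (b := p) hl
      exact ⟨l', hl'⟩
  refine ⟨{p // {p} ∈ Y}, inferInstance, inferInstance, Y.onVertices,
    (hY.pullback _).hasSD2StarLinks, hconn, fun y => ⟨?_⟩⟩
  exact eH.trans <| eY.trans <| (MulEquiv.ofBijective _ (bijective_map_val o')).symm.trans <|
    (Y.onVertices.edgeGroupEquiv o' ho').trans <|
      FundamentalGroup.fundamentalGroupMulEquivOfPathConnected _ _

end PreAbstractSimplicialComplex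

theorem mainTheorem10 {V : Type*} [Fintype V] [DecidableEq V] (k : ℕ) (hk : 6 ≤ k)
    (X : PreAbstractSimplicialComplex V) (hX : X.HasSD2StarLinks k)
    (x : X.Realization) (H : Subgroup (FundamentalGroup X.Realization x))
    (hH : Group.IsFinitelyPresented H) :
    ∃ (W : Type) (_ : Fintype W) (_ : DecidableEq W) (Y : PreAbstractSimplicialComplex W),
      Y.HasSD2StarLinks k ∧ PathConnectedSpace Y.Realization ∧
        ∀ y : Y.Realization, Nonempty (H ≃* FundamentalGroup Y.Realization y) :=
  hX.exists_fundamentalGroup_mulEquiv x H hH
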